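/- Let $\{X_{ni}\}_{n,i\ge1}$ be i.i.d. random variables with values in $\{0,1,2,\dots\}$ and generating function $A(x)=\sum_{j\ge0}a_jx^j$, and let $\{Y_n\}_{n\ge1}$ be i.i.d. random variables with values in $\{0,1,2,\dots\}$ and generating function $B(x)=\sum_{j\ge0}b_jx^j$, the two families being independent of each other. Define the Galton–Watson process with immigration by $$Z_0=0,\qquad Z_n=\sum_{i=1}^{Z_{n-1}}X_{ni}+Y_n\quad(n\ge1).$$ Assume condition (H): $0<a_0<1$, $0<b_0<1$, $\sum_{j\ge1}a_jj^2\log j<\infty$, $\sum_{j\ge1}b_jj^2<\infty$, $E(X_{11})=1$, $0<\beta:=B'(1-)<\infty$ and $0<\gamma:=\tfrac12A''(1-)<\infty$. Put $\sigma=\beta/\gamma$. Assume moreover that $E(X_{11}^{2r+\delta})<\infty$ and $E(Y_1^{r})<\infty$ for some $\delta>0$ and some $r>\max\{\sigma,1\}$. Then for every $\varepsilon>0$ there is a finite number $q(\varepsilon)\ge0$ such that $$\lim_{n\to\infty}n^{\sigma}\,P\Big\{\Big|\frac{Z_{n+1}}{Z_n}-1\Big|>\varepsilon\,\Big|\,Z_n>0\Big\}=q(\varepsilon).$$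 Moreover $q(\varepsilon)>0$ if and only if the deviation is possible at all, that is, $P\{Z_n>0,\ |Z_{n+1}/Z_n-1|>\varepsilon\}>0$ for at least one $n$; in particular $q(\varepsilon)>0$ whenever $0<\varepsilon\le1$. -/

import Mathlib

open MeasureTheory ProbabilityTheory Filter Topology

/-- The (real) generating function `x ↦ ∑ j, p j * x ^ j` of a sequence `p`. -/
noncomputable def genFun (p : ℕ → ℝ) (x : ℝ) : ℝ := ∑' j : ℕ, p j * x ^ j

/-- The point masses `j ↦ P (V = j)` of an `ℕ`-valued random variable `V`. -/
noncomputable def pointMass {Ω : Type*} [MeasurableSpace Ω] (P : Measure Ω) (V : Ω → ℕ)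
    (j : ℕ) : ℝ := P.real {ω | V ω = j}

/-- The input of a Galton-Watson process with immigration.  Indices start at `0`:
`X n i` is the number of children, in generation `n + 1`, of the `(i + 1)`-st individual of
generation `n` (usually written `X_{n+1,i+1}`), and `Y n` is the number of immigrants into
generation `n + 1` (usually written `Y_{n+1}`).  The `X n i` are i.i.d., the `Y n` are i.i.d.,
and the two families are independent of each other. -/
structure IsGWIInput {Ω : Type*} [MeasurableSpace Ω] (P : Measure Ω)
    (X : ℕ → ℕ → Ω → ℕ) (Y : ℕ → Ω → ℕ) : Prop where
  measurable_X : ∀ n i, Measurable (X n i)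
  measurable_Y : ∀ n, Measurable (Y n)
  indep_X : iIndepFun (fun p : ℕ × ℕ => X p.1 p.2) P
  indep_Y : iIndepFun Y P
  indep_XY : IndepFun (fun ω (p : ℕ × ℕ) => X p.1 p.2 ω) (fun ω (n : ℕ) => Y n ω) P
  identDistrib_X : ∀ n i, IdentDistrib (X n i) (X 0 0) P P
  identDistrib_Y : ∀ n, IdentDistrib (Y n) (Y 0) P P

/-- The Galton-Watson process with immigration, started from `0`. -/
def gwi {Ω : Type*} (X : ℕ → ℕ → Ω → ℕ) (Y : ℕ → Ω → ℕ) : ℕ → Ω → ℕ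
  | 0, _ => 0
  | n + 1, ω => (∑ i ∈ Finset.range (gwi X Y n ω), X n i ω) + Y n ω

/-- The standing assumption on the offspring law `a`, with generating function `A`, and the
immigration law `b`, with generating function `B`: both laws charge `0` but are not
concentrated there, `∑ a_j j² log j` and `∑ b_j j²` are finite, the offspring mean is `1`,
`β = B'(1-)` and `γ = A''(1-) / 2`, both finite and positive. -/
structure ConditionH {Ω : Type*} [MeasurableSpace Ω] (P : Measure Ω)
    (X : ℕ → ℕ → Ω → ℕ) (Y : ℕ → Ω → ℕ) (β γ : ℝ) : Prop where
  a_zero_pos : 0 < pointMass P (X 0 0) 0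
  a_zero_lt_one : pointMass P (X 0 0) 0 < 1
  b_zero_pos : 0 < pointMass P (Y 0) 0
  b_zero_lt_one : pointMass P (Y 0) 0 < 1
  summable_a : Summable fun j : ℕ => pointMass P (X 0 0) j * (j : ℝ) ^ 2 * Real.log j
  summable_b : Summable fun j : ℕ => pointMass P (Y 0) j * (j : ℝ) ^ 2
  mean_offspring : ∫ ω, (X 0 0 ω : ℝ) ∂P = 1
  tendsto_beta : Tendsto (deriv (genFun (pointMass P (Y 0)))) (𝓝[<] 1) (𝓝 β)
  tendsto_gamma :
    Tendsto (fun x => (1 / 2 : ℝ) * iteratedDeriv 2 (genFun (pointMass P (X 0 0))) x)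
      (𝓝[<] 1) (𝓝 γ)
  beta_pos : 0 < β
  gamma_pos : 0 < γ

/-- The event `|Z_{n+1} / Z_n - 1| > ε`; it is only used together with `Z_n > 0`. -/
def ratioDeviation {Ω : Type*} (X : ℕ → ℕ → Ω → ℕ) (Y : ℕ → Ω → ℕ) (ε : ℝ) (n : ℕ) : Set Ω :=
  {ω | ε < |(gwi X Y (n + 1) ω : ℝ) / (gwi X Y n ω : ℝ) - 1|}

open Asymptotics
open scoped ENNReal

/-! Write `p n` for the law of `Z_n`, and let `φ k` be the probability that `k` individuals and one
batch of immigrants deviate in one step. By the Markov property the deviation event together with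
`Z_n > 0` has probability `∑ k, p n k * φ k`.

Monotonicity: `Z_{n+1}` is distributed as `Z_n` plus an independent variable, the descendants of the
first batch of immigrants. Hence `p n k / p n 0` is nondecreasing in `n` for each `k`, and so is `s
n = (∑ k, p n k * φ k) / p n 0`. Its limit exists as a supremum and is positive as soon as one term
is.

Boundedness: `φ k = O(k ^ (-r))`, by truncation and a Chernoff bound, while `∑ k ≤ m, p n k ≤ C * m
^ σ * p n 0` uniformly in `n`. Since `σ < r`, summation by parts bounds `s n`.

Scale: `p n 0 = ∏ k < n, B (A^k 0)`. With `t k = 1 - A^k 0`, the expansions of `A` and `B` at `1`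
give `t (k+1) = t k - γ (t k)² + …` and `B (1 - t k) = 1 - β t k + …`, so `t k ~ 1 / (γ k)` and `n ^
σ * p n 0 → L > 0`. In particular `P (Z_n > 0) → 1`, and `q = L * sup s`. -/

theorem ENNReal.tsum_tsum_eq_tsum_sum_antidiagonal (u : ℕ → ℕ → ℝ≥0∞) :
    ∑' i, ∑' j, u i j = ∑' n, ∑ p ∈ Finset.HasAntidiagonal.antidiagonal n, u p.1 p.2 := by
  rw [← ENNReal.tsum_prod, ← (Finset.HasAntidiagonal.sigmaAntidiagonalEquivProd (A := ℕ)).tsum_eq,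
    ENNReal.tsum_sigma']
  refine tsum_congr fun n => ?_
  simp only [Finset.HasAntidiagonal.sigmaAntidiagonalEquivProd_apply]
  exact Finset.tsum_subtype (Finset.HasAntidiagonal.antidiagonal n) fun p : ℕ × ℕ => u p.1 p.2

/-! ### Generating functions as power series over `[0, ∞]`, where every sum converges and may be
interchanged. -/

namespace PowerSeries

/-- The sum of a power series with coefficients in `[0, ∞]`. -/
noncomputable def ennEval (f : PowerSeries ℝ≥0∞) (x : ℝ≥0∞) : ℝ≥0∞ :=
  ∑' j, coeff j f * x ^ j

/-- The power series `∑ k, f k * a ^ k`, which makes sense without any condition on the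
constant coefficient of `a` since the coefficients are in `[0, ∞]`. -/
noncomputable def ennSubst (a f : PowerSeries ℝ≥0∞) : PowerSeries ℝ≥0∞ :=
  mk fun j => ∑' k, coeff k f * coeff j (a ^ k)

theorem coeff_ennSubst (a f : PowerSeries ℝ≥0∞) (j : ℕ) :
    coeff j (ennSubst a f) = ∑' k, coeff k f * coeff j (a ^ k) := by
  simp [ennSubst]

theorem ennEval_mul (f g : PowerSeries ℝ≥0∞) (x : ℝ≥0∞) :
    ennEval (f * g) x = ennEval f x * ennEval g x := by
  simp only [ennEval, coeff_mul]
  rw [← ENNReal.tsum_mul_right]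
  simp_rw [← ENNReal.tsum_mul_left]
  rw [ENNReal.tsum_tsum_eq_tsum_sum_antidiagonal]
  refine tsum_congr fun n => ?_
  rw [Finset.sum_mul]
  refine Finset.sum_congr rfl fun p hp => ?_
  rw [← Finset.HasAntidiagonal.mem_antidiagonal.mp hp, pow_add]
  ring

theorem ennEval_one (x : ℝ≥0∞) : ennEval 1 x = 1 := by
  rw [ennEval, tsum_eq_single 0]
  · simp
  · intro j hj; simp [coeff_one, hj]

theorem ennEval_pow (f : PowerSeries ℝ≥0∞) (x : ℝ≥0∞) (k : ℕ) :
    ennEval (f ^ k) x = ennEval f x ^ k := by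
  induction k with
  | zero => simp [ennEval_one]
  | succ k ih => rw [pow_succ, ennEval_mul, ih, pow_succ]

theorem ennEval_zero (f : PowerSeries ℝ≥0∞) : ennEval f 0 = coeff 0 f := by
  rw [ennEval, tsum_eq_single 0]
  · simp
  · intro j hj; simp [hj]

theorem ennEval_ennSubst (a f : PowerSeries ℝ≥0∞) (x : ℝ≥0∞) :
    ennEval (ennSubst a f) x = ennEval f (ennEval a x) := by
  simp only [ennEval, coeff_ennSubst]
  simp_rw [← ENNReal.tsum_mul_right]
  rw [ENNReal.tsum_comm]
  refine tsum_congr fun k => ?_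
  simp_rw [mul_assoc]
  rw [ENNReal.tsum_mul_left]
  congr 1
  exact ennEval_pow a x k

theorem ennSubst_one (a : PowerSeries ℝ≥0∞) : ennSubst a 1 = 1 := by
  ext j
  rw [coeff_ennSubst, tsum_eq_single 0]
  · simp
  · intro k hk; simp [coeff_one, hk]

/-- Since `a ^ (k + l) = a ^ k * a ^ l`, both sides are the same double Cauchy product, regrouped
over the exponents `k, l` and over the degrees. This is what lets an immigration factor be pulled
out of the recursion. -/
theorem ennSubst_mul (a f g : PowerSeries ℝ≥0∞) :
    ennSubst a (f * g) = ennSubst a f * ennSubst a g := by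
  ext j
  simp only [coeff_mul, coeff_ennSubst]
  have h : ∀ p : ℕ × ℕ,
      (∑' k, coeff k f * coeff p.1 (a ^ k)) * (∑' l, coeff l g * coeff p.2 (a ^ l)) =
      ∑' m, ∑ q ∈ Finset.HasAntidiagonal.antidiagonal m,
        coeff q.1 f * coeff p.1 (a ^ q.1) * (coeff q.2 g * coeff p.2 (a ^ q.2)) := by
    intro p
    rw [← ENNReal.tsum_tsum_eq_tsum_sum_antidiagonal fun k l =>
      coeff k f * coeff p.1 (a ^ k) * (coeff l g * coeff p.2 (a ^ l)), ← ENNReal.tsum_mul_right]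
    simp_rw [← ENNReal.tsum_mul_left]
  simp_rw [h]
  rw [← Summable.tsum_finsetSum fun _ _ => ENNReal.summable]
  refine tsum_congr fun m => ?_
  rw [Finset.sum_comm, Finset.sum_mul]
  refine Finset.sum_congr rfl fun q hq => ?_
  rw [← Finset.HasAntidiagonal.mem_antidiagonal.mp hq, pow_add, coeff_mul, Finset.mul_sum]
  refine Finset.sum_congr rfl fun p _ => ?_
  ring

section Immigration

variable {a b : PowerSeries ℝ≥0∞} {p : ℕ → PowerSeries ℝ≥0∞}

/-- If `p (n + 1) = ennSubst a (p n) * b` and `p 0 = 1`, then `p (n + 1)` is the product of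
`p n` and an iterated substitution of `b`. -/
theorem succ_eq_mul_iterate (h0 : p 0 = 1) (hs : ∀ n, p (n + 1) = ennSubst a (p n) * b)
    (n : ℕ) : p (n + 1) = p n * (ennSubst a)^[n] b := by
  induction n with
  | zero => simp [hs, h0, ennSubst_one]
  | succ n ih =>
    rw [hs (n + 1), ih, ennSubst_mul, mul_right_comm, ← hs n, ← ih,
      Function.iterate_succ_apply']

theorem ennEval_iterate_ennSubst (n : ℕ) (x : ℝ≥0∞) :
    ennEval ((ennSubst a)^[n] b) x = ennEval b ((ennEval a)^[n] x) := by
  induction n generalizing x with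
  | zero => rfl
  | succ n ih =>
    rw [Function.iterate_succ_apply', ennEval_ennSubst, ih, Function.iterate_succ_apply]

/-- The batches of immigrants evolve independently; the factor with index `k` is the contribution of
the batch that has aged `k` generations. -/
theorem ennEval_eq_prod (h0 : p 0 = 1) (hs : ∀ n, p (n + 1) = ennSubst a (p n) * b)
    (n : ℕ) (x : ℝ≥0∞) :
    ennEval (p n) x = ∏ k ∈ Finset.range n, ennEval b ((ennEval a)^[k] x) := by
  induction n with
  | zero => simp [h0, ennEval_one]
  | succ n ih =>
    rw [succ_eq_mul_iterate h0 hs, ennEval_mul, ih, ennEval_iterate_ennSubst,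
      Finset.prod_range_succ]

/-- With `p (n + 1) = p n * q`, the constant coefficient is exactly `p n 0 * q 0`, while the `j`-th
one is at least `p n j * q 0`. So the ratio of the `j`-th to the zeroth coefficient cannot decrease
with `n`; it is stated without division. -/
theorem coeff_zero_mul_coeff_succ_ge (h0 : p 0 = 1)
    (hs : ∀ n, p (n + 1) = ennSubst a (p n) * b) (n j : ℕ) :
    coeff j (p n) * coeff 0 (p (n + 1)) ≤ coeff j (p (n + 1)) * coeff 0 (p n) := by
  rw [succ_eq_mul_iterate h0 hs, coeff_mul 0]
  simp only [Finset.Nat.antidiagonal_zero, Finset.sum_singleton]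
  rw [← mul_assoc, mul_right_comm]
  gcongr
  rw [coeff_mul]
  exact Finset.single_le_sum (f := fun q : ℕ × ℕ => coeff q.1 (p n) *
    coeff q.2 ((ennSubst a)^[n] b)) (fun _ _ => zero_le) (a := (j, 0)) (by simp)

end Immigration

end PowerSeries

/-- The law of an `ℕ`-valued random variable, as a power series. -/
noncomputable def lawSeries {Ω : Type*} [MeasurableSpace Ω] (P : Measure Ω) (V : Ω → ℕ) :
    PowerSeries ℝ≥0∞ :=
  PowerSeries.mk fun j => P {ω | V ω = j}

theorem coeff_lawSeries {Ω : Type*} [MeasurableSpace Ω] (P : Measure Ω) (V : Ω → ℕ) (j : ℕ) :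
    PowerSeries.coeff j (lawSeries P V) = P {ω | V ω = j} := by
  simp [lawSeries]

/-! ### Laws of `ℕ`-valued variables and independence. -/

section Law

variable {Ω : Type*} [MeasurableSpace Ω] {P : Measure Ω}

theorem measurableSet_eq_natCast {V : Ω → ℕ} (hV : Measurable V) (j : ℕ) :
    MeasurableSet {ω | V ω = j} := hV (measurableSet_singleton j)

theorem measure_eq_tsum_inter {V : Ω → ℕ} (hV : Measurable V) (s : Set Ω) :
    P s = ∑' k, P ({ω | V ω = k} ∩ s) := by
  have : (⋃ k, {ω | V ω = k}) = Set.univ := by ext; simp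
  rw [← Measure.restrict_apply_univ s, ← this, measure_iUnion _ (measurableSet_eq_natCast hV)]
  · exact tsum_congr fun k => Measure.restrict_apply (measurableSet_eq_natCast hV k)
  · intro i j hij
    refine Set.disjoint_left.mpr ?_
    rintro ω h1 h2
    exact hij (Eq.trans (Eq.symm h1) h2)

theorem measure_preimage_eq_tsum {V : Ω → ℕ} (hV : Measurable V) (s : Set ℕ) [DecidablePred (· ∈ s)] :
    P (V ⁻¹' s) = ∑' j, if j ∈ s then P {ω | V ω = j} else 0 := by
  rw [measure_eq_tsum_inter hV]
  refine tsum_congr fun j => ?_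
  split_ifs with h
  · congr 1; ext ω; simp only [Set.mem_inter_iff, Set.mem_ofPred_eq, Set.mem_preimage]
    constructor
    · exact fun h => h.1
    · rintro rfl; exact ⟨rfl, h⟩
  · rw [measure_eq_zero_iff_ae_notMem]
    refine ae_of_all _ fun ω hω => h ?_
    simpa [hω.1.symm] using hω.2

theorem lawSeries_add {U V : Ω → ℕ} (hU : Measurable U) (hV : Measurable V)
    (h : IndepFun U V P) : lawSeries P (fun ω => U ω + V ω) = lawSeries P U * lawSeries P V := by
  ext j
  rw [PowerSeries.coeff_mul]
  simp only [coeff_lawSeries]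
  have : {ω | U ω + V ω = j} = ⋃ q ∈ Finset.HasAntidiagonal.antidiagonal j,
      U ⁻¹' {q.1} ∩ V ⁻¹' {q.2} := by
    ext ω; simp
  rw [this, measure_biUnion_finset]
  · refine Finset.sum_congr rfl fun q _ => ?_
    exact h.measure_inter_preimage_eq_mul _ _ (measurableSet_singleton _)
      (measurableSet_singleton _)
  · rintro q - q' - hqq
    refine Set.disjoint_left.mpr ?_
    rintro ω ⟨h1, h2⟩ ⟨h3, h4⟩
    simp only [Set.mem_preimage, Set.mem_singleton_iff] at h1 h2 h3 h4
    exact hqq (Prod.ext (h1.symm.trans h3) (h2.symm.trans h4))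
  · exact fun q _ => (hU (measurableSet_singleton _)).inter (hV (measurableSet_singleton _))

theorem lawSeries_congr {Ω' : Type*} [MeasurableSpace Ω'] {P' : Measure Ω'} {U : Ω → ℕ}
    {V : Ω' → ℕ} (h : IdentDistrib U V P P') : lawSeries P U = lawSeries P' V := by
  ext j
  simp only [coeff_lawSeries]
  exact h.measure_mem_eq (measurableSet_singleton j)

/-- Two independent families of independent random variables form an independent family. -/
theorem iIndepFun_sumElim {ι κ β : Type*} [MeasurableSpace β] {X : ι → Ω → β} {Y : κ → Ω → β}
    (hX : iIndepFun X P) (hY : iIndepFun Y P)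
    (hXY : IndepFun (fun ω i => X i ω) (fun ω k => Y k ω) P) :
    iIndepFun (Sum.elim X Y : ι ⊕ κ → Ω → β) P := by
  rw [iIndepFun_iff_measure_inter_preimage_eq_mul]
  intro S sets hS
  have hXm := hX.measure_inter_preimage_eq_mul S.toLeft (sets := fun i => sets (Sum.inl i))
    (fun i hi => hS _ (Finset.mem_toLeft.mp hi))
  have hYm := hY.measure_inter_preimage_eq_mul S.toRight (sets := fun i => sets (Sum.inr i))
    (fun i hi => hS _ (Finset.mem_toRight.mp hi))
  have hA : MeasurableSet (⋂ i ∈ S.toLeft, (fun f : ι → β => f i) ⁻¹' sets (Sum.inl i)) :=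
    S.toLeft.measurableSet_biInter fun i hi =>
      measurable_pi_apply i (hS _ (Finset.mem_toLeft.mp hi))
  have hB : MeasurableSet (⋂ i ∈ S.toRight, (fun f : κ → β => f i) ⁻¹' sets (Sum.inr i)) :=
    S.toRight.measurableSet_biInter fun i hi =>
      measurable_pi_apply i (hS _ (Finset.mem_toRight.mp hi))
  have h := hXY.measure_inter_preimage_eq_mul _ _ hA hB
  simp only [Set.preimage_iInter, ← Set.preimage_comp] at h
  have hprod : ∏ i ∈ S, P ((Sum.elim X Y : ι ⊕ κ → Ω → β) i ⁻¹' sets i) =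
      (∏ i ∈ S.toLeft, P (X i ⁻¹' sets (Sum.inl i))) *
        ∏ i ∈ S.toRight, P (Y i ⁻¹' sets (Sum.inr i)) := by
    conv_lhs => rw [← Finset.toLeft_disjSum_toRight (u := S), Finset.prod_disjSum]
    rfl
  rw [hprod, ← hXm, ← hYm]
  refine Eq.trans ?_ h
  congr 1
  ext ω
  simp [Set.mem_iInter]

end Law

/-! ### The Markov property and the recursion for the law of the process. -/

section GaltonWatson

/-- The `n`-th generation is determined by the input of the first `n` steps. -/
theorem measurable_gwi_of_lt {Ω : Type*} {X : ℕ → ℕ → Ω → ℕ}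
    {Y : ℕ → Ω → ℕ} {m : MeasurableSpace Ω} (n : ℕ)
    (hX : ∀ k < n, ∀ i, Measurable[m] (X k i)) (hY : ∀ k < n, Measurable[m] (Y k)) :
    Measurable[m] (gwi X Y n) := by
  induction n with
  | zero => exact measurable_const
  | succ n ih =>
    have hZ := ih (fun k hk => hX k (by omega)) (fun k hk => hY k (by omega))
    have hS : Measurable[m] fun ω => ∑ i ∈ Finset.range (gwi X Y n ω), X n i ω := by
      have h2 : Measurable[m] fun ω => (gwi X Y n ω, fun k => ∑ i ∈ Finset.range k, X n i ω) :=
        hZ.prodMk (measurable_pi_lambda _ fun k =>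
          Finset.measurable_sum _ fun i _ => hX n (by omega) i)
      have h3 : Measurable fun q : ℕ × (ℕ → ℕ) => q.2 q.1 :=
        measurable_from_prod_countable_right fun k => measurable_pi_apply k
      exact h3.comp h2
    exact hS.add (hY n (by omega))

variable {Ω : Type*} [MeasurableSpace Ω] {P : Measure Ω}
  {X : ℕ → ℕ → Ω → ℕ} {Y : ℕ → Ω → ℕ}

namespace IsGWIInput

variable (h : IsGWIInput P X Y)
include h

theorem measurable_gwi (n : ℕ) : Measurable (gwi X Y n) :=
  measurable_gwi_of_lt n (fun k _ i => h.measurable_X k i) fun k _ => h.measurable_Y k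

/-- The number of children of the first `k` individuals plus the number of immigrants. -/
theorem measurable_sum_add (n k : ℕ) :
    Measurable fun ω => ∑ i ∈ Finset.range k, X n i ω + Y n ω :=
  (Finset.measurable_sum _ fun i _ => h.measurable_X n i).add (h.measurable_Y n)

theorem lawSeries_sum (n k : ℕ) :
    lawSeries P (fun ω => ∑ i ∈ Finset.range k, X n i ω) = lawSeries P (X 0 0) ^ k := by
  have hi : iIndepFun (X n) P :=
    h.indep_X.precomp (g := fun i => (n, i)) fun i j hij => (Prod.mk.inj hij).2
  have : IsProbabilityMeasure P := hi.isProbabilityMeasure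
  induction k with
  | zero =>
    ext j
    rw [coeff_lawSeries]
    rcases j with _ | j
    · simp
    · simp [PowerSeries.coeff_one]
  | succ k ih =>
    simp_rw [Finset.sum_range_succ]
    rw [lawSeries_add (Finset.measurable_sum _ fun i _ => h.measurable_X n i)
      (h.measurable_X n k), ih, pow_succ, lawSeries_congr (h.identDistrib_X n k)]
    have := hi.indepFun_sum_range_succ (h.measurable_X n) k
    convert this using 1
    ext ω; simp

theorem lawSeries_sum_add (n k : ℕ) :
    lawSeries P (fun ω => ∑ i ∈ Finset.range k, X n i ω + Y n ω) =
      lawSeries P (X 0 0) ^ k * lawSeries P (Y 0) := by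
  rw [lawSeries_add (Finset.measurable_sum _ fun i _ => h.measurable_X n i) (h.measurable_Y n),
    h.lawSeries_sum, lawSeries_congr (h.identDistrib_Y n)]
  exact h.indep_XY.comp (φ := fun f : ℕ × ℕ → ℕ => ∑ i ∈ Finset.range k, f (n, i))
    (ψ := fun f : ℕ → ℕ => f n) (Finset.measurable_sum _ fun i _ => measurable_pi_apply _)
    (measurable_pi_apply n)

/-- The left variable depends only on inputs with time index below `n`, the right one only on inputs
with time index `n`; disjoint blocks of an independent family are independent. -/
theorem indepFun_gwi (n k : ℕ) :
    IndepFun (gwi X Y n) (fun ω => ∑ i ∈ Finset.range k, X n i ω + Y n ω) P := by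
  have hW := iIndepFun_sumElim h.indep_X h.indep_Y h.indep_XY
  set W : (ℕ × ℕ) ⊕ ℕ → Ω → ℕ := Sum.elim (fun p : ℕ × ℕ => X p.1 p.2) Y with hWdef
  let g : (ℕ × ℕ) ⊕ ℕ → ℕ := Sum.elim Prod.fst id
  have hWm : ∀ i, Measurable (W i) := by
    rintro (p | m)
    · exact h.measurable_X _ _
    · exact h.measurable_Y _
  have key := indep_iSup_of_disjoint (fun i => (hWm i).comap_le) hW.iIndep
    (S := {i | g i < n}) (T := {i | g i = n})
    (Set.disjoint_left.mpr fun i hi hi' => by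
      simp only [Set.mem_ofPred_eq] at hi hi'; omega)
  have hle : ∀ (S : Set ((ℕ × ℕ) ⊕ ℕ)) (i), i ∈ S →
      Measurable[⨆ i ∈ S, MeasurableSpace.comap (W i) inferInstance] (W i) := by
    intro S i hi
    exact (comap_measurable (W i)).mono
      (le_iSup₂ (f := fun i (_ : i ∈ S) => MeasurableSpace.comap (W i) inferInstance) i hi) le_rfl
  rw [IndepFun_iff_Indep]
  refine indep_of_indep_of_le key ?_ ?_
  · refine (measurable_gwi_of_lt n ?_ ?_).comap_le
    · exact fun k hk i => hle {i | g i < n} (Sum.inl (k, i)) hk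
    · exact fun k hk => hle {i | g i < n} (Sum.inr k) hk
  · refine Measurable.comap_le ?_
    refine Measurable.add ?_ ?_
    · exact Finset.measurable_sum _ fun i _ => hle {i | g i = n} (Sum.inl (n, i)) rfl
    · exact hle {i | g i = n} (Sum.inr n) rfl

/-- The Markov property: on `Z_n = k` the random sum has a fixed number `k` of terms, which are
independent of `Z_n`. -/
theorem measure_gwi_inter (n k : ℕ) (s : Set ℕ) :
    P ({ω | gwi X Y n ω = k} ∩ (gwi X Y (n + 1)) ⁻¹' s) =
      P {ω | gwi X Y n ω = k} * P ((fun ω => ∑ i ∈ Finset.range k, X n i ω + Y n ω) ⁻¹' s) := by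
  rw [show {ω | gwi X Y n ω = k} = gwi X Y n ⁻¹' {k} from rfl,
    ← (h.indepFun_gwi n k).measure_inter_preimage_eq_mul _ _ (measurableSet_singleton k)
      (MeasurableSet.of_discrete)]
  congr 1
  ext ω
  simp only [Set.mem_inter_iff, Set.mem_preimage, Set.mem_singleton_iff, gwi]
  constructor
  · rintro ⟨h1, h2⟩; rw [h1] at h2; exact ⟨h1, h2⟩
  · rintro ⟨h1, h2⟩; rw [h1]; exact ⟨rfl, h2⟩

theorem lawSeries_gwi_zero : lawSeries P (gwi X Y 0) = 1 := by
  have : IsProbabilityMeasure P := h.indep_X.isProbabilityMeasure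
  ext j
  rw [coeff_lawSeries]
  rcases j with _ | j
  · simp [gwi]
  · simp [gwi, PowerSeries.coeff_one]

theorem lawSeries_gwi_succ (n : ℕ) :
    lawSeries P (gwi X Y (n + 1)) =
      PowerSeries.ennSubst (lawSeries P (X 0 0)) (lawSeries P (gwi X Y n)) *
        lawSeries P (Y 0) := by
  ext j
  rw [coeff_lawSeries, measure_eq_tsum_inter (h.measurable_gwi n), PowerSeries.coeff_mul]
  simp only [PowerSeries.coeff_ennSubst]
  simp_rw [← ENNReal.tsum_mul_right]
  rw [← Summable.tsum_finsetSum fun _ _ => ENNReal.summable]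
  refine tsum_congr fun k => ?_
  rw [show {ω | gwi X Y (n + 1) ω = j} = gwi X Y (n + 1) ⁻¹' {j} from rfl, h.measure_gwi_inter,
    show ((fun ω => ∑ i ∈ Finset.range k, X n i ω + Y n ω) ⁻¹' {j}) =
      {ω | ∑ i ∈ Finset.range k, X n i ω + Y n ω = j} from rfl,
    ← coeff_lawSeries, ← coeff_lawSeries P (fun ω => ∑ i ∈ Finset.range k, X n i ω + Y n ω),
    h.lawSeries_sum_add, PowerSeries.coeff_mul, Finset.mul_sum]
  exact Finset.sum_congr rfl fun q _ => (mul_assoc _ _ _).symm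

end IsGWIInput

end GaltonWatson

/-! ### Taylor bounds for `(1 - t) ^ j`, and expansions of generating functions at `1`. -/

theorem one_sub_pow_taylor_one_nonneg {t : ℝ} (ht1 : t ≤ 1) (j : ℕ) :
    0 ≤ (1 - t) ^ j - 1 + j * t := by
  have := one_add_mul_le_pow (a := -t) (by linarith) j
  rw [sub_eq_add_neg 1 t]; linarith

theorem one_sub_pow_taylor_one_succ (t : ℝ) (j : ℕ) :
    (1 - t) ^ (j + 1) - 1 + ((j + 1 : ℕ) : ℝ) * t =
      ((1 - t) ^ j - 1 + j * t) * (1 - t) + j * t ^ 2 := by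
  push_cast; ring

theorem one_sub_pow_taylor_one_le {t : ℝ} (ht0 : 0 ≤ t) (ht1 : t ≤ 1) (j : ℕ) :
    (1 - t) ^ j - 1 + j * t ≤ (j * t) ^ 2 := by
  induction j with
  | zero => simp
  | succ j ih =>
    rw [one_sub_pow_taylor_one_succ]
    have h0 := one_sub_pow_taylor_one_nonneg ht1 j
    have : ((1 - t) ^ j - 1 + j * t) * (1 - t) ≤ ((1 - t) ^ j - 1 + j * t) :=
      mul_le_of_le_one_right h0 (by linarith)
    push_cast
    have hj : (0 : ℝ) ≤ j := j.cast_nonneg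
    nlinarith [mul_nonneg hj (sq_nonneg t), sq_nonneg t]

theorem le_one_sub_pow_taylor_one {t : ℝ} (ht1 : t ≤ 1) {j : ℕ} (hj : 2 ≤ j) :
    t ^ 2 ≤ (1 - t) ^ j - 1 + j * t := by
  induction j, hj using Nat.le_induction with
  | base => apply le_of_eq; push_cast; ring
  | succ j hj ih =>
    rw [one_sub_pow_taylor_one_succ]
    have hj' : (2 : ℝ) ≤ j := by exact_mod_cast hj
    have h0 := one_sub_pow_taylor_one_nonneg ht1 j
    nlinarith [mul_nonneg h0 (sub_nonneg.mpr ht1), sq_nonneg t]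

theorem abs_one_sub_pow_taylor_two_le {t : ℝ} (ht0 : 0 ≤ t) (ht1 : t ≤ 1) (j : ℕ) :
    |(1 - t) ^ j - 1 + j * t - j * (j - 1) / 2 * t ^ 2| ≤ (j * t) ^ 3 := by
  induction j with
  | zero => simp
  | succ j ih =>
    have h0 := one_sub_pow_taylor_one_nonneg ht1 j
    have h1 := one_sub_pow_taylor_one_le ht0 ht1 j
    have e : (1 - t) ^ (j + 1) - 1 + ((j + 1 : ℕ) : ℝ) * t -
        ((j + 1 : ℕ) : ℝ) * (((j + 1 : ℕ) : ℝ) - 1) / 2 * t ^ 2 =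
        ((1 - t) ^ j - 1 + j * t - j * (j - 1) / 2 * t ^ 2) -
          t * ((1 - t) ^ j - 1 + j * t) := by
      push_cast; ring
    rw [e]
    have h2 : |t * ((1 - t) ^ j - 1 + j * t)| ≤ t * (j * t) ^ 2 := by
      rw [abs_of_nonneg (mul_nonneg ht0 h0)]
      exact mul_le_mul_of_nonneg_left h1 ht0
    refine (abs_sub _ _).trans ((add_le_add ih h2).trans ?_)
    push_cast
    have hj : (0 : ℝ) ≤ j := j.cast_nonneg
    have h3 : 0 ≤ t ^ 3 := pow_nonneg ht0 3
    nlinarith [mul_nonneg (mul_nonneg hj hj) h3, mul_nonneg hj h3]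

/-- Interpolation: the cubic bound serves for `j * t ≤ 1`, the quadratic one for `j * t ≥ 1`. It
permits a second-order expansion when only a moment of order `2 + η` is finite. -/
theorem abs_one_sub_pow_taylor_two_le_rpow {t : ℝ} (ht0 : 0 ≤ t) (ht1 : t ≤ 1) (j : ℕ) {η : ℝ}
    (hη0 : 0 ≤ η) (hη1 : η ≤ 1) :
    |(1 - t) ^ j - 1 + j * t - j * (j - 1) / 2 * t ^ 2| ≤ 2 * (j * t) ^ (2 + η) := by
  have hj : (0 : ℝ) ≤ j := j.cast_nonneg
  have hs : 0 ≤ (j : ℝ) * t := mul_nonneg hj ht0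
  rcases le_total ((j : ℝ) * t) 1 with h | h
  · have h1 := abs_one_sub_pow_taylor_two_le ht0 ht1 j
    have h2 : ((j : ℝ) * t) ^ 3 ≤ (j * t) ^ (2 + η) := by
      rcases hs.eq_or_lt with h0 | h0
      · rw [← h0]; simpa using Real.rpow_nonneg le_rfl _
      · rw [← Real.rpow_natCast]
        exact Real.rpow_le_rpow_of_exponent_ge h0 h (by push_cast; linarith)
    have := Real.rpow_nonneg hs (2 + η)
    linarith
  · have h1 := one_sub_pow_taylor_one_nonneg ht1 j
    have h2 := one_sub_pow_taylor_one_le ht0 ht1 j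
    have h3 : ((j : ℝ) * t) ^ 2 ≤ (j * t) ^ (2 + η) := by
      rw [← Real.rpow_natCast]
      exact Real.rpow_le_rpow_of_exponent_le h (by push_cast; linarith)
    have h4 : 0 ≤ (j : ℝ) * (j - 1) / 2 * t ^ 2 := by
      rcases j with _ | j
      · simp
      · push_cast; simp only [add_sub_cancel_right]; positivity
    have h5 : (j : ℝ) * (j - 1) / 2 * t ^ 2 ≤ (j * t) ^ 2 := by
      have : (j * t) ^ 2 - (j : ℝ) * (j - 1) / 2 * t ^ 2 = (j * j + j) / 2 * t ^ 2 := by ring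
      have h6 : 0 ≤ ((j : ℝ) * j + j) / 2 * t ^ 2 := by positivity
      linarith
    rw [abs_le]; constructor <;> linarith

theorem Nat.cast_pow_le_cast_rpow (j : ℕ) {m : ℕ} {s : ℝ} (hm : (m : ℝ) ≤ s) (hs : 0 < s)
    (h0 : m ≠ 0) : (j : ℝ) ^ m ≤ (j : ℝ) ^ s := by
  rcases Nat.eq_zero_or_pos j with rfl | hj
  · simp [h0, Real.zero_rpow hs.ne']
  · rw [← Real.rpow_natCast]
    exact Real.rpow_le_rpow_of_exponent_le (by exact_mod_cast hj) hm

section GenFun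

variable {a : ℕ → ℝ}

theorem summable_mul_pow_of_nonneg (h0 : ∀ j, 0 ≤ a j) (ha : Summable a) {x : ℝ} (hx0 : 0 ≤ x)
    (hx1 : x ≤ 1) : Summable fun j => a j * x ^ j :=
  ha.of_nonneg_of_le (fun j => mul_nonneg (h0 j) (pow_nonneg hx0 j))
    fun j => mul_le_of_le_one_right (h0 j) (pow_le_one₀ hx0 hx1)

theorem genFun_taylor_one_eq (h0 : ∀ j, 0 ≤ a j) (ha : Summable a)
    (ha1 : Summable fun j => a j * (j : ℝ)) {t : ℝ} (ht0 : 0 ≤ t) (ht1 : t ≤ 1) :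
    HasSum (fun j => a j * ((1 - t) ^ j - 1 + j * t))
      (genFun a (1 - t) - ∑' j, a j + (∑' j, a j * (j : ℝ)) * t) := by
  have h := ((summable_mul_pow_of_nonneg h0 ha (x := 1 - t) (by linarith)
    (by linarith)).hasSum.sub ha.hasSum).add (ha1.hasSum.mul_right t)
  have e : (fun j => a j * ((1 - t) ^ j - 1 + j * t)) =
      fun j => a j * (1 - t) ^ j - a j + a j * (j : ℝ) * t := by funext j; ring
  rw [e]
  exact h

theorem abs_genFun_taylor_one_le (h0 : ∀ j, 0 ≤ a j) (ha : Summable a)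
    (ha1 : Summable fun j => a j * (j : ℝ)) (ha2 : Summable fun j => a j * (j : ℝ) ^ 2)
    {t : ℝ} (ht0 : 0 ≤ t) (ht1 : t ≤ 1) :
    |genFun a (1 - t) - ∑' j, a j + (∑' j, a j * (j : ℝ)) * t| ≤
      (∑' j, a j * (j : ℝ) ^ 2) * t ^ 2 := by
  have h := genFun_taylor_one_eq h0 ha ha1 ht0 ht1
  rw [abs_of_nonneg (h.nonneg fun j => mul_nonneg (h0 j) (one_sub_pow_taylor_one_nonneg ht1 j))]
  refine hasSum_le (fun j => ?_) h (ha2.hasSum.mul_right (t ^ 2))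
  rw [mul_assoc, ← mul_pow]
  exact mul_le_mul_of_nonneg_left (one_sub_pow_taylor_one_le ht0 ht1 j) (h0 j)

theorem abs_genFun_taylor_two_le (h0 : ∀ j, 0 ≤ a j) (ha : Summable a)
    (ha1 : Summable fun j => a j * (j : ℝ))
    (ha2 : Summable fun j => a j * ((j : ℝ) * (j - 1))) {η : ℝ} (hη0 : 0 ≤ η) (hη1 : η ≤ 1)
    (ha3 : Summable fun j => a j * (j : ℝ) ^ (2 + η))
    {t : ℝ} (ht0 : 0 ≤ t) (ht1 : t ≤ 1) :
    |genFun a (1 - t) - ∑' j, a j + (∑' j, a j * (j : ℝ)) * t -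
        1 / 2 * (∑' j, a j * ((j : ℝ) * (j - 1))) * t ^ 2| ≤
      2 * (∑' j, a j * (j : ℝ) ^ (2 + η)) * t ^ (2 + η) := by
  have h := (genFun_taylor_one_eq h0 ha ha1 ht0 ht1).sub
    ((ha2.hasSum.mul_left (1 / 2 : ℝ)).mul_right (t ^ 2))
  have hb := (ha3.hasSum.mul_left (2 : ℝ)).mul_right (t ^ (2 + η))
  rw [← h.tsum_eq, ← hb.tsum_eq]
  have hle : ∀ j, ‖a j * ((1 - t) ^ j - 1 + j * t) - 1 / 2 * (a j * ((j : ℝ) * (j - 1))) * t ^ 2‖ ≤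
      2 * (a j * (j : ℝ) ^ (2 + η)) * t ^ (2 + η) := by
    intro j
    have e : a j * ((1 - t) ^ j - 1 + j * t) - 1 / 2 * (a j * ((j : ℝ) * (j - 1))) * t ^ 2 =
        a j * ((1 - t) ^ j - 1 + j * t - j * (j - 1) / 2 * t ^ 2) := by ring
    have e2 : 2 * (a j * (j : ℝ) ^ (2 + η)) * t ^ (2 + η) =
        a j * (2 * (j * t) ^ (2 + η)) := by
      rw [Real.mul_rpow j.cast_nonneg ht0]; ring
    rw [e, e2, norm_mul, Real.norm_of_nonneg (h0 j)]
    exact mul_le_mul_of_nonneg_left (abs_one_sub_pow_taylor_two_le_rpow ht0 ht1 j hη0 hη1) (h0 j)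
  exact tsum_of_norm_bounded hb.summable.hasSum hle

theorem hasDerivAt_genFun {c : ℕ → ℝ} (hc : Summable fun j => |c j| * (j : ℝ)) {x : ℝ}
    (hx : |x| < 1) :
    HasDerivAt (genFun c) (genFun (fun j => c (j + 1) * ((j : ℝ) + 1)) x) x := by
  have h := hasDerivAt_tsum_of_isPreconnected (t := Metric.ball (0 : ℝ) 1) (y₀ := 0) (y := x)
    (g := fun j x => c j * x ^ j) (g' := fun j x => c j * (j * x ^ (j - 1))) hc
    Metric.isOpen_ball (convex_ball (0 : ℝ) 1).isPreconnected
    (fun j y _ => (hasDerivAt_pow j y).const_mul (c j)) ?_ (by simp) ?_ (by simpa using hx)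
  · have hval : ∑' j, c j * (j * x ^ (j - 1)) =
        genFun (fun j => c (j + 1) * ((j : ℝ) + 1)) x := by
      rw [Summable.tsum_eq_zero_add]
      · simp only [Nat.cast_zero, zero_mul, mul_zero, zero_add, genFun]
        refine tsum_congr fun j => ?_
        simp only [add_tsub_cancel_right, Nat.cast_add, Nat.cast_one]
        ring
      · refine hc.of_norm_bounded fun j => ?_
        rw [norm_mul, norm_mul, Real.norm_natCast, norm_pow, Real.norm_eq_abs, Real.norm_eq_abs]
        exact mul_le_mul_of_nonneg_left (mul_le_of_le_one_right j.cast_nonneg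
          (pow_le_one₀ (abs_nonneg x) hx.le)) (abs_nonneg _)
    rw [← hval]
    exact h
  · intro j y hy
    have hy : |y| < 1 := by simpa using hy
    rw [norm_mul, norm_mul, Real.norm_natCast, norm_pow, Real.norm_eq_abs, Real.norm_eq_abs]
    exact mul_le_mul_of_nonneg_left (mul_le_of_le_one_right j.cast_nonneg
        (pow_le_one₀ (abs_nonneg y) hy.le)) (abs_nonneg _)
  · exact summable_of_ne_finset_zero (s := {0}) fun j hj => by
      simp only [Finset.mem_singleton] at hj; simp [hj]

theorem tendsto_genFun_nhdsLT_one {c : ℕ → ℝ} (hc : Summable c) :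
    Tendsto (genFun c) (𝓝[<] 1) (𝓝 (∑' j, c j)) :=
  Real.tendsto_tsum_powerSeries_nhdsWithin_lt hc.hasSum.tendsto_sum_nat

theorem eventually_abs_lt_one : ∀ᶠ x : ℝ in 𝓝[<] 1, |x| < 1 := by
  filter_upwards [Ioo_mem_nhdsLT (show (0 : ℝ) < 1 by norm_num)] with x hx
  rw [abs_of_pos hx.1]; exact hx.2

/-- Termwise differentiation inside the unit disc and Abel's theorem. It identifies the limit `β` in
`ConditionH` with a mean; the second-derivative version does the same for `γ`. -/
theorem tendsto_deriv_genFun (h0 : ∀ j, 0 ≤ a j) (ha1 : Summable fun j => a j * (j : ℝ)) :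
    Tendsto (deriv (genFun a)) (𝓝[<] 1) (𝓝 (∑' j, a j * (j : ℝ))) := by
  have hs : Summable fun j => a (j + 1) * ((j : ℝ) + 1) := by
    simpa using (summable_nat_add_iff 1).mpr ha1
  have hlim := tendsto_genFun_nhdsLT_one hs
  rw [ha1.tsum_eq_zero_add]
  simp only [Nat.cast_zero, mul_zero, zero_add, Nat.cast_add, Nat.cast_one]
  refine hlim.congr' ?_
  filter_upwards [eventually_abs_lt_one] with x hx
  exact (hasDerivAt_genFun (by simpa only [abs_of_nonneg (h0 _)] using ha1) hx).deriv.symm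

theorem tendsto_iteratedDeriv_two_genFun (h0 : ∀ j, 0 ≤ a j)
    (ha1 : Summable fun j => a j * (j : ℝ))
    (ha2 : Summable fun j => a j * ((j : ℝ) * (j - 1))) :
    Tendsto (iteratedDeriv 2 (genFun a)) (𝓝[<] 1) (𝓝 (∑' j, a j * ((j : ℝ) * (j - 1)))) := by
  have hs : Summable fun j => a (j + 1) * ((j : ℝ) + 1) * j := by
    have := (summable_nat_add_iff 1).mpr ha2
    refine this.congr fun j => ?_
    push_cast; ring
  have hlim := tendsto_deriv_genFun (a := fun j => a (j + 1) * ((j : ℝ) + 1))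
    (fun j => mul_nonneg (h0 _) (by positivity)) hs
  rw [ha2.tsum_eq_zero_add]
  simp only [Nat.cast_zero, mul_zero, zero_mul, zero_add, Nat.cast_add, Nat.cast_one,
    add_sub_cancel_right]
  simp_rw [← mul_assoc]
  refine hlim.congr' ?_
  filter_upwards [eventually_abs_lt_one] with x hx
  rw [iteratedDeriv_succ, iteratedDeriv_one]
  refine Filter.EventuallyEq.deriv_eq ?_
  have : ∀ᶠ y : ℝ in 𝓝 x, |y| < 1 := continuous_abs.continuousAt.eventually_lt_const hx
  filter_upwards [this] with y hy
  exact (hasDerivAt_genFun (by simpa only [abs_of_nonneg (h0 _)] using ha1) hy).deriv.symm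

end GenFun

/-! ### Asymptotics of the recursion `t (k + 1) = t k - γ (t k)² + …`. -/

section Recursion

variable {t : ℕ → ℝ} {c : ℝ}

/-- The inverse grows by at least `c` per step, because `(t - c t²) (t⁻¹ + c) = 1 - (c t)² ≤ 1`. -/
theorem one_add_mul_le_inv_of_le_sub_sq (h0 : t 0 = 1) (hpos : ∀ k, 0 < t k) (hc : 0 < c)
    (hle : ∀ k, t (k + 1) ≤ t k - c * t k ^ 2) (k : ℕ) : 1 + c * k ≤ (t k)⁻¹ := by
  induction k with
  | zero => simp [h0]
  | succ k ih =>
    have hk := hpos k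
    have hlt : 0 < 1 - c * t k := by
      have h1 : 0 < t k * (1 - c * t k) := by
        have := (hpos (k + 1)).trans_le (hle k); linarith
      exact pos_of_mul_pos_right h1 hk.le
    have h1 : (t k)⁻¹ + c ≤ (t (k + 1))⁻¹ := by
      rw [le_inv_comm₀ (by positivity) (hpos _)]
      refine (hle k).trans ?_
      rw [← one_div, le_div_iff₀ (by positivity)]
      have : (t k - c * t k ^ 2) * ((t k)⁻¹ + c) = 1 - (c * t k) ^ 2 := by
        field_simp; ring
      rw [this]; linarith [sq_nonneg (c * t k)]
    push_cast; linarith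

/-- `1 - s ≥ (1 + 1/(c m))⁻¹ ≥ exp (-1/(c m))`, raised to the power `m`. The bound does not depend
on `m`. -/
theorem exp_neg_inv_le_one_sub_pow (hc : 0 < c) {m : ℕ} (hm : 0 < m) {s : ℝ}
    (hs : s ≤ (1 + c * m)⁻¹) : Real.exp (-c⁻¹) ≤ (1 - s) ^ m := by
  have hm' : (0 : ℝ) < m := by exact_mod_cast hm
  have hu : 0 < 1 + (c * m)⁻¹ := by positivity
  have h1 : (1 + (c * m)⁻¹)⁻¹ ≤ 1 - s := by
    have : 1 - (1 + c * m)⁻¹ = (1 + (c * m)⁻¹)⁻¹ := by field_simp; ring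
    rw [← this]; linarith
  have h2 : Real.exp (-(c * m)⁻¹) ≤ (1 + (c * m)⁻¹)⁻¹ := by
    rw [Real.exp_neg]
    refine inv_anti₀ hu ?_
    rw [add_comm]; exact Real.add_one_le_exp _
  calc Real.exp (-c⁻¹) = Real.exp (-(c * m)⁻¹) ^ m := by
        rw [← Real.exp_nat_mul]; congr 1; field_simp
    _ ≤ (1 - s) ^ m := pow_le_pow_left₀ (Real.exp_pos _).le (h2.trans h1) m

theorem summable_rpow_of_le_inv (hpos : ∀ k, 0 < t k) (hc : 0 < c)
    (hle : ∀ k : ℕ, 1 + c * k ≤ (t k)⁻¹) {s : ℝ} (hs : 1 < s) : Summable fun k => t k ^ s := by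
  have h1 : ∀ k : ℕ, t (k + 1) ^ s ≤ (c⁻¹) ^ s * (((k + 1 : ℕ) : ℝ) ^ s)⁻¹ := by
    intro k
    have hk : (0 : ℝ) < ((k + 1 : ℕ) : ℝ) := by positivity
    rw [← Real.inv_rpow hk.le, ← Real.mul_rpow (by positivity) (by positivity)]
    refine Real.rpow_le_rpow (hpos _).le ?_ (by linarith)
    rw [← mul_inv, le_inv_comm₀ (hpos _) (by positivity)]
    linarith [hle (k + 1)]
  rw [← summable_nat_add_iff 1]
  refine Summable.of_nonneg_of_le (fun k => Real.rpow_nonneg (hpos _).le _) h1 ?_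
  exact Summable.mul_left _ ((summable_nat_add_iff (f := fun k : ℕ => ((k : ℝ) ^ s)⁻¹) 1).mpr
    (Real.summable_nat_rpow_inv.mpr hs))

theorem log_one_sub_add_isBigO {l : Filter ℕ} {u : ℕ → ℝ} (hu : Tendsto u l (𝓝 0)) :
    (fun k => Real.log (1 - u k) + u k) =O[l] fun k => u k ^ 2 := by
  refine IsBigO.of_bound 2 ?_
  have : ∀ᶠ k in l, |u k| < 1 / 2 :=
    (continuous_abs.tendsto' 0 0 abs_zero |>.comp hu).eventually_lt_const (by norm_num)
  filter_upwards [this] with k hk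
  have h := Real.abs_log_sub_add_sum_range_le (x := u k) (by linarith) 1
  simp only [Finset.sum_range_one, zero_add, pow_one, Nat.cast_zero, div_one,
    Nat.reduceAdd] at h
  rw [Real.norm_eq_abs, add_comm, norm_pow, Real.norm_eq_abs]
  refine h.trans ?_
  rw [div_le_iff₀ (by linarith)]
  nlinarith [sq_nonneg |u k|]

/-- Asymptotics of the products `∏ G (t k)` along a recursion `t (k + 1) = t k - γ (t k)² + …`,
where `G s = 1 - β s + …`. -/
theorem tendsto_rpow_mul_prod {w x : ℕ → ℝ} {β γ η : ℝ} (h0 : t 0 = 1) (hpos : ∀ k, 0 < t k)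
    (hγ : 0 < γ) (hη0 : 0 < η) (hη1 : η ≤ 1) (hc : 0 < c)
    (hle : ∀ k : ℕ, 1 + c * k ≤ (t k)⁻¹)
    (hw : ∀ k, t (k + 1) = t k * (1 - w k))
    (hwt : (fun k => w k - γ * t k) =O[atTop] fun k => t k ^ (1 + η))
    (hx1 : ∀ k, x k < 1)
    (hxt : (fun k => x k - β * t k) =O[atTop] fun k => t k ^ (1 + η)) :
    ∃ L : ℝ, 0 < L ∧ Tendsto (fun n : ℕ => (n : ℝ) ^ (β / γ) * ∏ k ∈ Finset.range n, (1 - x k))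
      atTop (𝓝 L) := by
  have hw1 : ∀ k, 0 < 1 - w k := fun k =>
    pos_of_mul_pos_right ((hw k) ▸ hpos (k + 1)) (hpos k).le
  have ht : Tendsto t atTop (𝓝 0) := by
    have h1 : Tendsto (fun k : ℕ => (1 + c * (k : ℝ))⁻¹) atTop (𝓝 0) :=
      tendsto_inv_atTop_zero.comp (tendsto_atTop_add_const_left _ _
        (tendsto_natCast_atTop_atTop.const_mul_atTop hc))
    refine squeeze_zero (fun k => (hpos k).le) (fun k => ?_) h1
    rw [le_inv_comm₀ (hpos k) (by positivity)]
    exact hle k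
  have ht1 : ∀ᶠ k in atTop, t k ≤ 1 := ht.eventually_le_const one_pos
  have hbt : (fun k => t k ^ (1 + η)) =O[atTop] t := by
    refine IsBigO.of_bound 1 ?_
    filter_upwards [ht1] with k hk
    rw [Real.norm_of_nonneg (Real.rpow_nonneg (hpos k).le _), Real.norm_of_nonneg (hpos k).le,
      one_mul]
    exact (Real.rpow_le_rpow_of_exponent_ge (hpos k) hk (by linarith)).trans_eq (Real.rpow_one _)
  have hsq : (fun k => t k ^ 2) =O[atTop] fun k => t k ^ (1 + η) := by
    refine IsBigO.of_bound 1 ?_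
    filter_upwards [ht1] with k hk
    rw [Real.norm_of_nonneg (Real.rpow_nonneg (hpos k).le _), Real.norm_of_nonneg (by positivity),
      one_mul, ← Real.rpow_natCast]
    exact Real.rpow_le_rpow_of_exponent_ge (hpos k) hk (by push_cast; linarith)
  have hwO : w =O[atTop] t := by
    have := (hwt.trans hbt).add ((isBigO_refl t atTop).const_mul_left γ)
    simpa using this
  have hxO : x =O[atTop] t := by
    have := (hxt.trans hbt).add ((isBigO_refl t atTop).const_mul_left β)
    simpa using this
  have hw0 : Tendsto w atTop (𝓝 0) := hwO.trans_tendsto ht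
  have hx0 : Tendsto x atTop (𝓝 0) := hxO.trans_tendsto ht
  -- `1 / (n t n)` tends to `γ`
  have hwγ : Tendsto (fun k => w k / t k) atTop (𝓝 γ) := by
    have h1 : Tendsto (fun k => (w k - γ * t k) / t k) atTop (𝓝 0) := by
      have h2 : Tendsto (fun k => t k ^ (1 + η) / t k) atTop (𝓝 0) := by
        have h3 : Tendsto (fun k => t k ^ η) atTop (𝓝 0) := by
          have := ht.rpow_const (p := η) (Or.inr hη0.le)
          rwa [Real.zero_rpow hη0.ne'] at this
        refine h3.congr fun k => ?_
        rw [Real.rpow_add (hpos k), Real.rpow_one, mul_div_cancel_left₀ _ (hpos k).ne']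
      exact (hwt.mul (isBigO_refl (fun k => (t k)⁻¹) atTop)).trans_tendsto h2
    have h4 := h1.add_const γ
    rw [zero_add] at h4
    refine h4.congr fun k => ?_
    have := (hpos k).ne'
    field_simp; ring
  have hdiff : Tendsto (fun k => (t (k + 1))⁻¹ - (t k)⁻¹) atTop (𝓝 γ) := by
    have h1 := hwγ.div (hw0.const_sub 1) (by norm_num)
    rw [sub_zero, div_one] at h1
    refine h1.congr fun k => ?_
    have h2 := (hpos k).ne'
    have h3 := (hw1 k).ne'
    simp only [Pi.div_apply]
    rw [hw k]
    field_simp; ring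
  have hinv : Tendsto (fun n : ℕ => (n : ℝ)⁻¹ * (t n)⁻¹) atTop (𝓝 γ) := by
    have h1 := hdiff.cesaro
    simp_rw [Finset.sum_range_sub (fun k => (t k)⁻¹), h0] at h1
    have h2 := h1.add (tendsto_inv_atTop_nhds_zero_nat (𝕜 := ℝ))
    rw [add_zero] at h2
    refine h2.congr fun n => ?_
    rw [inv_one]; ring
  have hnt : Tendsto (fun n : ℕ => ((n : ℝ) * t n) ^ (β / γ)) atTop (𝓝 ((γ⁻¹) ^ (β / γ))) := by
    have h1 := (hinv.inv₀ hγ.ne').rpow_const (p := β / γ) (Or.inl (inv_ne_zero hγ.ne'))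
    refine h1.congr fun n => ?_
    rw [mul_inv, inv_inv, inv_inv]
  -- the product, normalised by a power of `t n`
  set ℓ : ℕ → ℝ := fun k => Real.log (1 - x k) - β / γ * Real.log (1 - w k) with hℓ
  -- The linear terms `-β t` and `(β / γ) * γ t` cancel, which is why the exponent is `β / γ`; the
  -- remainder is summable.
  have hℓO : ℓ =O[atTop] fun k => t k ^ (1 + η) := by
    have h1 := (log_one_sub_add_isBigO hx0).trans ((hxO.pow 2).trans hsq)
    have h2 := (log_one_sub_add_isBigO hw0).trans ((hwO.pow 2).trans hsq)
    have h3 := ((h1.sub (h2.const_mul_left (β / γ))).sub hxt).add (hwt.const_mul_left (β / γ))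
    refine h3.congr_left fun k => ?_
    rw [hℓ]
    field_simp; ring
  have hsum : Summable ℓ := summable_of_isBigO_nat
    (summable_rpow_of_le_inv hpos hc hle (by linarith : 1 < 1 + η)) hℓO
  -- As `t 0 = 1`, the factors `1 - w k` telescope to `t n`, which absorbs the subtracted
  -- logarithms.
  have hprod : ∀ n, ∏ k ∈ Finset.range n, (1 - x k) =
      Real.exp (∑ k ∈ Finset.range n, ℓ k) * t n ^ (β / γ) := by
    intro n
    induction n with
    | zero => simp [h0]
    | succ n ih =>
      rw [Finset.prod_range_succ, ih, Finset.sum_range_succ, Real.exp_add, hw n,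
        Real.mul_rpow (hpos n).le (hw1 n).le, Real.rpow_def_of_pos (hw1 n)]
      have : Real.exp (ℓ n) * Real.exp (Real.log (1 - w n) * (β / γ)) = 1 - x n := by
        rw [← Real.exp_add, hℓ]
        simp only
        rw [mul_comm (β / γ), sub_add_cancel, Real.exp_log (by linarith [hx1 n])]
      rw [← this]; ring
  refine ⟨Real.exp (∑' k, ℓ k) * (γ⁻¹) ^ (β / γ), by positivity, ?_⟩
  have h1 := ((Real.continuous_exp.tendsto _).comp hsum.hasSum.tendsto_sum_nat).mul hnt
  refine h1.congr fun n => ?_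
  rw [hprod, Real.mul_rpow n.cast_nonneg (hpos n).le]
  simp only [Function.comp]
  ring

end Recursion

/-! ### Polynomial tail bounds for sums of i.i.d. nonnegative variables of mean one. -/

theorem Real.exp_le_one_add_add_sq_mul_exp {u : ℝ} (hu : 0 ≤ u) :
    Real.exp u ≤ 1 + u + u ^ 2 * Real.exp u := by
  have h1 : Real.exp u ≤ 1 + u * Real.exp u := by
    have := mul_le_mul_of_nonneg_left (Real.one_sub_le_exp_neg u) (Real.exp_pos u).le
    rw [← Real.exp_add, add_neg_cancel, Real.exp_zero] at this
    linarith
  nlinarith [mul_le_mul_of_nonneg_left h1 hu]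

theorem Real.exp_neg_le_one_sub_add_sq {u : ℝ} (hu : 0 ≤ u) :
    Real.exp (-u) ≤ 1 - u + u ^ 2 := by
  have h1 : Real.exp (-u) ≤ (1 + u)⁻¹ := by
    rw [Real.exp_neg]
    exact inv_anti₀ (by linarith) (by rw [add_comm]; exact Real.add_one_le_exp u)
  refine h1.trans ?_
  rw [← one_div, div_le_iff₀ (by linarith)]
  nlinarith [pow_nonneg hu 3]

theorem sq_log_le_sixteen_mul_rpow {x : ℝ} (hx : 1 ≤ x) :
    Real.log x ^ 2 ≤ 16 * x ^ (1 / 2 : ℝ) := by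
  have h1 := Real.log_le_rpow_div (x := x) (by linarith) (show (0 : ℝ) < 1 / 4 by norm_num)
  have h2 : Real.log x ^ 2 ≤ (x ^ (1 / 4 : ℝ) / (1 / 4)) ^ 2 :=
    pow_le_pow_left₀ (Real.log_nonneg hx) h1 2
  refine h2.trans_eq ?_
  rw [div_pow, ← Real.rpow_natCast, ← Real.rpow_mul (by linarith)]
  norm_num
  ring

section Tail

variable {Ω : Type*} [MeasurableSpace Ω] {P : Measure Ω}

theorem mgf_sum_range_le {W : ℕ → Ω → ℝ} (hm : ∀ i, Measurable (W i)) (hi : iIndepFun W P)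
    (hid : ∀ i, IdentDistrib (W i) (W 0) P P) {s κ : ℝ} (hκ : mgf (W 0) P s ≤ Real.exp κ)
    (k : ℕ) : mgf (∑ i ∈ Finset.range k, W i) P s ≤ Real.exp (k * κ) := by
  rw [hi.mgf_sum hm, Finset.prod_congr rfl fun i _ =>
    mgf_congr_of_identDistrib (W i) (W 0) (hid i) s, Finset.prod_const, Finset.card_range,
    Real.exp_nat_mul]
  exact pow_le_pow_left₀ mgf_nonneg hκ k

theorem integrable_exp_mul_of_le [IsFiniteMeasure P] {V : Ω → ℝ} (hV : Measurable V) {s M : ℝ}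
    (hM : ∀ ω, s * V ω ≤ M) : Integrable (fun ω => Real.exp (s * V ω)) P := by
  refine Integrable.of_bound (hV.const_mul s).exp.aestronglyMeasurable (Real.exp M)
    (ae_of_all _ fun ω => ?_)
  rw [Real.norm_of_nonneg (Real.exp_pos _).le]
  exact Real.exp_le_exp.mpr (hM ω)

theorem measureReal_sum_ge_le [IsFiniteMeasure P] {W : ℕ → Ω → ℝ} (hm : ∀ i, Measurable (W i))
    (hi : iIndepFun W P) (hid : ∀ i, IdentDistrib (W i) (W 0) P P) {s κ M : ℝ} (hs : 0 ≤ s)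
    (hM : ∀ i ω, s * W i ω ≤ M) (hκ : mgf (W 0) P s ≤ Real.exp κ) (k : ℕ) (v : ℝ) :
    P.real {ω | v ≤ (∑ i ∈ Finset.range k, W i) ω} ≤ Real.exp (-s * v + k * κ) := by
  rw [Real.exp_add]
  exact (measure_ge_le_exp_mul_mgf v hs (hi.integrable_exp_mul_sum hm fun i _ =>
    integrable_exp_mul_of_le (hm i) (hM i))).trans
    (mul_le_mul_of_nonneg_left (mgf_sum_range_le hm hi hid hκ k) (Real.exp_pos _).le)

theorem measureReal_sum_le_le [IsFiniteMeasure P] {W : ℕ → Ω → ℝ} (hm : ∀ i, Measurable (W i))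
    (hi : iIndepFun W P) (hid : ∀ i, IdentDistrib (W i) (W 0) P P) {s κ M : ℝ} (hs : s ≤ 0)
    (hM : ∀ i ω, s * W i ω ≤ M) (hκ : mgf (W 0) P s ≤ Real.exp κ) (k : ℕ) (v : ℝ) :
    P.real {ω | (∑ i ∈ Finset.range k, W i) ω ≤ v} ≤ Real.exp (-s * v + k * κ) := by
  rw [Real.exp_add]
  exact (measure_le_le_exp_mul_mgf v hs (hi.integrable_exp_mul_sum hm fun i _ =>
    integrable_exp_mul_of_le (hm i) (hM i))).trans
    (mul_le_mul_of_nonneg_left (mgf_sum_range_le hm hi hid hκ k) (Real.exp_pos _).le)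

/-- Integrate the quadratic majorant and use `1 + x ≤ exp x`. The majorant is in `U`, so that `W`
may be a truncation of `U` whose own mean is never computed. -/
theorem mgf_le_exp_of_le [IsProbabilityMeasure P] {U W : Ω → ℝ} {s K : ℝ}
    (hU1 : Integrable U P) (hU2 : Integrable (fun ω => U ω ^ 2) P) (hmean : ∫ ω, U ω ∂P = 1)
    (hle : ∀ ω, Real.exp (s * W ω) ≤ 1 + s * U ω + K * U ω ^ 2) :
    mgf W P s ≤ Real.exp (s + K * ∫ ω, U ω ^ 2 ∂P) := by
  have hlin : Integrable (fun ω => 1 + s * U ω) P := (integrable_const 1).add (hU1.const_mul s)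
  have hint : Integrable (fun ω => 1 + s * U ω + K * U ω ^ 2) P := hlin.add (hU2.const_mul K)
  calc mgf W P s ≤ ∫ ω, (1 + s * U ω + K * U ω ^ 2) ∂P :=
        integral_mono_of_nonneg (ae_of_all _ fun ω => (Real.exp_pos _).le) hint
          (ae_of_all _ hle)
    _ = 1 + s + K * ∫ ω, U ω ^ 2 ∂P := by
        rw [integral_add hlin (hU2.const_mul K),
          integral_add (integrable_const 1) (hU1.const_mul s), integral_const_mul,
          integral_const_mul, hmean]
        simp
    _ ≤ _ := by
        rw [add_assoc, add_comm]; exact Real.add_one_le_exp _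

theorem measureReal_gt_le_moment [IsFiniteMeasure P] {V : Ω → ℝ} (hV : ∀ ω, 0 ≤ V ω) {p y : ℝ}
    (hp : 0 ≤ p) (hy : 0 < y) (hint : Integrable (fun ω => V ω ^ p) P) :
    P.real {ω | y < V ω} ≤ (∫ ω, V ω ^ p ∂P) * y ^ (-p) := by
  have h1 := mul_meas_ge_le_integral_of_nonneg
    (ae_of_all P fun ω => Real.rpow_nonneg (hV ω) p) hint (y ^ p)
  have h2 : P.real {ω | y < V ω} ≤ P.real {ω | y ^ p ≤ V ω ^ p} := by
    refine measureReal_mono fun ω hω => ?_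
    exact Real.rpow_le_rpow hy.le (le_of_lt hω) hp
  rw [Real.rpow_neg hy.le, ← div_eq_mul_inv, le_div_iff₀ (Real.rpow_pos_of_pos hy p), mul_comm]
  exact (mul_le_mul_of_nonneg_left h2 (Real.rpow_pos_of_pos hy p).le).trans h1

variable [IsProbabilityMeasure P] {U : ℕ → Ω → ℝ}

/-- Either one summand exceeds `M = θ k`, with probability `O(k ^ (1 - p))` by the moment of order
`p ≥ r + 1`, or the sum of the truncated variables is large, which a Chernoff bound with parameter
of order `log k / k` controls. -/
theorem exists_measureReal_sum_gt_le (hm : ∀ i, Measurable (U i)) (hi : iIndepFun U P)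
    (hid : ∀ i, IdentDistrib (U i) (U 0) P P) (h0 : ∀ i ω, 0 ≤ U i ω)
    (hU1 : Integrable (U 0) P) (hU2 : Integrable (fun ω => U 0 ω ^ 2) P)
    (hmean : ∫ ω, U 0 ω ∂P = 1) {r p : ℝ} (hr : 0 < r) (hp : r + 1 ≤ p)
    (hUp : Integrable (fun ω => U 0 ω ^ p) P) {ε : ℝ} (hε : 0 < ε) :
    ∃ C : ℝ, 0 ≤ C ∧ ∀ k : ℕ, 1 ≤ k →
      P.real {ω | (1 + ε) * k < ∑ i ∈ Finset.range k, U i ω} ≤ C * (k : ℝ) ^ (-r) := by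
  set m₂ := ∫ ω, U 0 ω ^ 2 ∂P with hm2
  have hm20 : 0 ≤ m₂ := integral_nonneg fun ω => sq_nonneg _
  set mp := ∫ ω, U 0 ω ^ p ∂P with hmp
  have hmp0 : 0 ≤ mp := integral_nonneg fun ω => Real.rpow_nonneg (h0 0 ω) p
  -- With `lam = s * log k / k` this makes `exp (-lam * ε * k)` equal to `k ^ (-r)`.
  set s := r / ε with hs
  have hs0 : 0 < s := div_pos hr hε
  -- The truncation level is chosen so that `exp (lam * M) = k ^ (1/2)`; the second-order term in
  -- the exponent then stays bounded, since `log² k ≤ 16 k ^ (1/2)`.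
  set θ := 1 / (2 * s) with hθ
  have hθ0 : 0 < θ := by positivity
  refine ⟨mp * θ ^ (-p) + Real.exp (16 * s ^ 2 * m₂), by positivity, fun k hk => ?_⟩
  have hk0 : (0 : ℝ) < k := by exact_mod_cast hk
  have hk1 : (1 : ℝ) ≤ k := by exact_mod_cast hk
  have hlog : 0 ≤ Real.log k := Real.log_nonneg hk1
  set M := θ * k with hM
  have hM0 : 0 < M := by positivity
  set lam := s * Real.log k / k with hlam
  have hlam0 : 0 ≤ lam := by positivity
  let W : ℕ → Ω → ℝ := fun i ω => min (U i ω) M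
  have hmin : Measurable fun x : ℝ => min x M := measurable_id.min measurable_const
  have hWm : ∀ i, Measurable (W i) := fun i => hmin.comp (hm i)
  have hWi : iIndepFun W P := hi.comp (fun _ x => min x M) fun _ => hmin
  have hWid : ∀ i, IdentDistrib (W i) (W 0) P P := fun i => (hid i).comp hmin
  have hlamM : lam * M = 1 / 2 * Real.log k := by
    rw [hlam, hM, hθ]; field_simp
  have hexpM : Real.exp (lam * M) = (k : ℝ) ^ (1 / 2 : ℝ) := by
    rw [hlamM, Real.rpow_def_of_pos hk0, mul_comm]
  have hmgf : mgf (W 0) P lam ≤ Real.exp (lam + lam ^ 2 * (k : ℝ) ^ (1 / 2 : ℝ) * m₂) := by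
    refine mgf_le_exp_of_le hU1 hU2 hmean fun ω => ?_
    have hW0 : 0 ≤ W 0 ω := le_min (h0 0 ω) hM0.le
    have hWU : W 0 ω ≤ U 0 ω := min_le_left _ _
    refine (Real.exp_le_one_add_add_sq_mul_exp (mul_nonneg hlam0 hW0)).trans ?_
    have h1 : lam * W 0 ω ≤ lam * U 0 ω := mul_le_mul_of_nonneg_left hWU hlam0
    have h2 : Real.exp (lam * W 0 ω) ≤ (k : ℝ) ^ (1 / 2 : ℝ) := by
      rw [← hexpM]
      exact Real.exp_le_exp.mpr (mul_le_mul_of_nonneg_left (min_le_right _ _) hlam0)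
    have h3 : (lam * W 0 ω) ^ 2 * Real.exp (lam * W 0 ω) ≤
        (lam * U 0 ω) ^ 2 * (k : ℝ) ^ (1 / 2 : ℝ) :=
      mul_le_mul (pow_le_pow_left₀ (mul_nonneg hlam0 hW0) h1 2) h2 (Real.exp_pos _).le
        (sq_nonneg _)
    have h4 : (lam * U 0 ω) ^ 2 * (k : ℝ) ^ (1 / 2 : ℝ) =
      lam ^ 2 * (k : ℝ) ^ (1 / 2 : ℝ) * U 0 ω ^ 2 := by ring
    linarith
  have hch := measureReal_sum_ge_le hWm hWi hWid hlam0
    (fun i ω => mul_le_mul_of_nonneg_left (min_le_right (U i ω) M) hlam0) hmgf k ((1 + ε) * k)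
  have hexp : Real.exp (-lam * ((1 + ε) * k) +
      k * (lam + lam ^ 2 * (k : ℝ) ^ (1 / 2 : ℝ) * m₂)) ≤
      Real.exp (16 * s ^ 2 * m₂) * (k : ℝ) ^ (-r) := by
    rw [Real.rpow_def_of_pos hk0 (-r), ← Real.exp_add]
    refine Real.exp_le_exp.mpr ?_
    have h1 : (k : ℝ) * (lam ^ 2 * (k : ℝ) ^ (1 / 2 : ℝ)) ≤ 16 * s ^ 2 := by
      have h2 := sq_log_le_sixteen_mul_rpow hk1
      have h3 : (k : ℝ) ^ (1 / 2 : ℝ) * (k : ℝ) ^ (1 / 2 : ℝ) = k := by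
        rw [← Real.rpow_add hk0]; norm_num
      have h4 : (k : ℝ) * (lam ^ 2 * (k : ℝ) ^ (1 / 2 : ℝ)) =
          s ^ 2 * (Real.log k ^ 2 * (k : ℝ) ^ (1 / 2 : ℝ)) / k := by
        rw [hlam]; field_simp
      rw [h4, div_le_iff₀ hk0]
      have h5 := mul_le_mul_of_nonneg_right h2 (Real.rpow_nonneg hk0.le (1 / 2 : ℝ))
      rw [mul_assoc, h3] at h5
      nlinarith [mul_le_mul_of_nonneg_left h5 (sq_nonneg s)]
    have h6 : lam * (ε * k) = r * Real.log k := by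
      rw [hlam, hs]; field_simp
    have h7 := mul_le_mul_of_nonneg_right h1 hm20
    nlinarith
  have hjump : ∀ i, P.real {ω | M < U i ω} ≤ mp * M ^ (-p) := by
    intro i
    have : P.real {ω | M < U i ω} = P.real {ω | M < U 0 ω} :=
      congrArg ENNReal.toReal ((hid i).measure_mem_eq measurableSet_Ioi)
    rw [this]
    exact measureReal_gt_le_moment (h0 0) (by linarith) hM0 hUp
  have hjump' : ∑ i ∈ Finset.range k, P.real {ω | M < U i ω} ≤
      mp * θ ^ (-p) * (k : ℝ) ^ (-r) := by
    refine (Finset.sum_le_sum fun i _ => hjump i).trans ?_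
    rw [Finset.sum_const, Finset.card_range, nsmul_eq_mul, hM, Real.mul_rpow hθ0.le hk0.le]
    have h1 : (k : ℝ) * (k : ℝ) ^ (-p) ≤ (k : ℝ) ^ (-r) := by
      rw [← Real.rpow_one_add' hk0.le (by linarith)]
      exact Real.rpow_le_rpow_of_exponent_le hk1 (by linarith)
    have h2 : 0 ≤ mp * θ ^ (-p) := by positivity
    nlinarith [mul_le_mul_of_nonneg_left h1 h2]
  have hsub : {ω | (1 + ε) * k < ∑ i ∈ Finset.range k, U i ω} ⊆
      (⋃ i ∈ Finset.range k, {ω | M < U i ω}) ∪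
        {ω | (1 + ε) * k ≤ (∑ i ∈ Finset.range k, W i) ω} := by
    intro ω hω
    by_cases hj : ∃ i ∈ Finset.range k, M < U i ω
    · obtain ⟨i, hi, hlt⟩ := hj
      exact Or.inl (Set.mem_biUnion hi hlt)
    · push Not at hj
      refine Or.inr ?_
      have : (∑ i ∈ Finset.range k, W i) ω = ∑ i ∈ Finset.range k, U i ω := by
        rw [Finset.sum_apply]
        exact Finset.sum_congr rfl fun i hi => min_eq_left (hj i hi)
      simp only [Set.mem_ofPred_eq] at hω ⊢
      rw [this]; exact hω.le
  calc _ ≤ _ := measureReal_mono hsub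
    _ ≤ _ := measureReal_union_le _ _
    _ ≤ mp * θ ^ (-p) * (k : ℝ) ^ (-r) + Real.exp (16 * s ^ 2 * m₂) * (k : ℝ) ^ (-r) :=
        add_le_add ((measureReal_biUnion_finset_le _ _).trans hjump') (hch.trans hexp)
    _ = _ := by ring

/-- The same Chernoff parameter with negative sign. No truncation is needed: `exp (-u) ≤ 1 - u + u²`
for `u ≥ 0`, so second moments suffice. -/
theorem exists_measureReal_sum_lt_le (hm : ∀ i, Measurable (U i)) (hi : iIndepFun U P)
    (hid : ∀ i, IdentDistrib (U i) (U 0) P P) (h0 : ∀ i ω, 0 ≤ U i ω)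
    (hU1 : Integrable (U 0) P) (hU2 : Integrable (fun ω => U 0 ω ^ 2) P)
    (hmean : ∫ ω, U 0 ω ∂P = 1) {r : ℝ} (hr : 0 < r) {ε : ℝ} (hε : 0 < ε) :
    ∃ C : ℝ, 0 ≤ C ∧ ∀ k : ℕ, 1 ≤ k →
      P.real {ω | ∑ i ∈ Finset.range k, U i ω < (1 - ε) * k} ≤ C * (k : ℝ) ^ (-r) := by
  set m₂ := ∫ ω, U 0 ω ^ 2 ∂P with hm2
  have hm20 : 0 ≤ m₂ := integral_nonneg fun ω => sq_nonneg _
  set s := r / ε with hs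
  have hs0 : 0 < s := div_pos hr hε
  refine ⟨Real.exp (16 * s ^ 2 * m₂), by positivity, fun k hk => ?_⟩
  have hk0 : (0 : ℝ) < k := by exact_mod_cast hk
  have hk1 : (1 : ℝ) ≤ k := by exact_mod_cast hk
  have hlog : 0 ≤ Real.log k := Real.log_nonneg hk1
  set lam := s * Real.log k / k with hlam
  have hlam0 : 0 ≤ lam := by positivity
  have hmgf : mgf (U 0) P (-lam) ≤ Real.exp (-lam + lam ^ 2 * m₂) := by
    refine mgf_le_exp_of_le hU1 hU2 hmean fun ω => ?_
    have h1 := Real.exp_neg_le_one_sub_add_sq (mul_nonneg hlam0 (h0 0 ω))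
    rw [neg_mul]
    linarith [mul_pow lam (U 0 ω) 2]
  have hch := measureReal_sum_le_le hm hi hid (neg_nonpos.mpr hlam0) (M := 0)
    (fun i ω => by rw [neg_mul]; exact neg_nonpos.mpr (mul_nonneg hlam0 (h0 i ω)))
    hmgf k ((1 - ε) * k)
  have hsub : {ω | ∑ i ∈ Finset.range k, U i ω < (1 - ε) * k} ⊆
      {ω | (∑ i ∈ Finset.range k, U i) ω ≤ (1 - ε) * k} := by
    intro ω hω
    simp only [Set.mem_ofPred_eq, Finset.sum_apply] at hω ⊢
    exact hω.le
  refine (measureReal_mono hsub).trans (hch.trans ?_)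
  rw [Real.rpow_def_of_pos hk0 (-r), ← Real.exp_add]
  refine Real.exp_le_exp.mpr ?_
  have h1 : (k : ℝ) * lam ^ 2 ≤ 16 * s ^ 2 := by
    have h2 := sq_log_le_sixteen_mul_rpow hk1
    have h3 : (k : ℝ) ^ (1 / 2 : ℝ) ≤ k :=
      (Real.rpow_le_rpow_of_exponent_le hk1 (by norm_num)).trans_eq (Real.rpow_one _)
    have h4 : (k : ℝ) * lam ^ 2 = s ^ 2 * Real.log k ^ 2 / k := by
      rw [hlam]; field_simp
    rw [h4, div_le_iff₀ hk0]
    nlinarith [mul_le_mul_of_nonneg_left (h2.trans (mul_le_mul_of_nonneg_left h3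
      (by norm_num : (0 : ℝ) ≤ 16))) (sq_nonneg s)]
  have h6 : lam * (ε * k) = r * Real.log k := by
    rw [hlam, hs]; field_simp
  have h7 := mul_le_mul_of_nonneg_right h1 hm20
  nlinarith

end Tail

/-! ### Iterates of a critical generating function. -/

section Critical

variable {a b : ℕ → ℝ}

/-- Otherwise `∑ a j * (1 - j)` would reduce to `a 0 > 0`, whereas it is `1 - 1 = 0`. -/
theorem exists_two_le_pos_of_mean_one (h0 : ∀ j, 0 ≤ a j) (ha : HasSum a 1)
    (ha1 : HasSum (fun j => a j * (j : ℝ)) 1) (ha0 : 0 < a 0) : ∃ j, 2 ≤ j ∧ 0 < a j := by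
  by_contra! hcon
  have h1 := ha.sub ha1
  have h2 : HasSum (fun j => a j - a j * (j : ℝ)) (a 0 - a 0 * ((0 : ℕ) : ℝ)) := by
    refine hasSum_single 0 fun j hj => ?_
    rcases Nat.lt_or_ge j 2 with h | h
    · have : j = 1 := by omega
      simp [this]
    · simp [le_antisymm (hcon j h) (h0 j)]
  have := h1.unique h2
  simp only [Nat.cast_zero, mul_zero, sub_zero, sub_self] at this
  linarith

theorem one_sub_genFun_le (h0 : ∀ j, 0 ≤ a j) (ha : HasSum a 1)
    (ha1 : HasSum (fun j => a j * (j : ℝ)) 1) {i : ℕ} (hi : 2 ≤ i) {s : ℝ} (hs0 : 0 ≤ s)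
    (hs1 : s ≤ 1) : 1 - genFun a (1 - s) ≤ s - a i * s ^ 2 := by
  have h := genFun_taylor_one_eq h0 ha.summable ha1.summable hs0 hs1
  rw [ha.tsum_eq, ha1.tsum_eq] at h
  have h2 := le_hasSum h i fun j _ => mul_nonneg (h0 j) (one_sub_pow_taylor_one_nonneg hs1 j)
  have h3 := mul_le_mul_of_nonneg_left (le_one_sub_pow_taylor_one hs1 hi) (h0 i)
  linarith

theorem genFun_lt_one (h0 : ∀ j, 0 ≤ a j) (ha : HasSum a 1) {i : ℕ} (hi : i ≠ 0) (hai : 0 < a i)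
    {x : ℝ} (hx0 : 0 ≤ x) (hx1 : x < 1) : genFun a x < 1 := by
  have hs := summable_mul_pow_of_nonneg h0 ha.summable hx0 hx1.le
  rw [← ha.tsum_eq]
  refine Summable.tsum_lt_tsum (i := i)
    (fun j => mul_le_of_le_one_right (h0 j) (pow_le_one₀ hx0 hx1.le)) ?_ hs ha.summable
  exact mul_lt_of_lt_one_right hai (pow_lt_one₀ hx0 hx1 hi)

theorem le_genFun (h0 : ∀ j, 0 ≤ a j) (ha : HasSum a 1) {x : ℝ} (hx0 : 0 ≤ x) (hx1 : x ≤ 1) :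
    a 0 ≤ genFun a x := by
  have hs := summable_mul_pow_of_nonneg h0 ha.summable hx0 hx1
  have := hs.le_tsum 0 fun j _ => mul_nonneg (h0 j) (pow_nonneg hx0 j)
  simpa [genFun] using this

theorem genFun_le_one (h0 : ∀ j, 0 ≤ a j) (ha : HasSum a 1) {x : ℝ} (hx0 : 0 ≤ x) (hx1 : x ≤ 1) :
    genFun a x ≤ 1 := by
  rw [← ha.tsum_eq]
  exact Summable.tsum_le_tsum (fun j => mul_le_of_le_one_right (h0 j) (pow_le_one₀ hx0 hx1))
    (summable_mul_pow_of_nonneg h0 ha.summable hx0 hx1) ha.summable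

theorem iterate_genFun_nonneg_le_one (h0 : ∀ j, 0 ≤ a j) (ha : HasSum a 1) (k : ℕ) :
    0 ≤ (genFun a)^[k] 0 ∧ (genFun a)^[k] 0 ≤ 1 := by
  induction k with
  | zero => simp
  | succ k ih =>
    rw [Function.iterate_succ_apply']
    exact ⟨(h0 0).trans (le_genFun h0 ha ih.1 ih.2), genFun_le_one h0 ha ih.1 ih.2⟩

theorem iterate_genFun_mem (h0 : ∀ j, 0 ≤ a j) (ha : HasSum a 1)
    (ha1 : HasSum (fun j => a j * (j : ℝ)) 1) (ha0 : 0 < a 0) (k : ℕ) :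
    0 ≤ (genFun a)^[k] 0 ∧ (genFun a)^[k] 0 < 1 := by
  obtain ⟨i, hi, hai⟩ := exists_two_le_pos_of_mean_one h0 ha ha1 ha0
  induction k with
  | zero => simp
  | succ k ih =>
    rw [Function.iterate_succ_apply']
    exact ⟨ha0.le.trans (le_genFun h0 ha ih.1 ih.2.le),
      genFun_lt_one h0 ha (by omega) hai ih.1 ih.2⟩

/-- A single atom `a i` with `i ≥ 2` already forces a quadratic decrease of `1 - A^k 0`, and `c = a
i` works. -/
theorem exists_one_add_mul_le_inv_one_sub_iterate (h0 : ∀ j, 0 ≤ a j) (ha : HasSum a 1)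
    (ha1 : HasSum (fun j => a j * (j : ℝ)) 1) (ha0 : 0 < a 0) :
    ∃ c : ℝ, 0 < c ∧ ∀ k : ℕ, 1 + c * k ≤ (1 - (genFun a)^[k] 0)⁻¹ := by
  obtain ⟨i, hi, hai⟩ := exists_two_le_pos_of_mean_one h0 ha ha1 ha0
  have hmem := iterate_genFun_mem h0 ha ha1 ha0
  refine ⟨a i, hai, one_add_mul_le_inv_of_le_sub_sq (t := fun k => 1 - (genFun a)^[k] 0)
    (by simp) (fun k => sub_pos.mpr (hmem k).2) hai fun k => ?_⟩
  have := one_sub_genFun_le h0 ha ha1 hi (s := 1 - (genFun a)^[k] 0)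
    (sub_pos.mpr (hmem k).2).le (by linarith [(hmem k).1])
  rw [sub_sub_cancel] at this
  rw [Function.iterate_succ_apply']
  exact this

/-- The asymptotics of the probability of being empty for a critical branching process with
immigration. -/
theorem exists_tendsto_rpow_mul_prod_genFun (h0 : ∀ j, 0 ≤ a j) (ha : HasSum a 1)
    (ha1 : HasSum (fun j => a j * (j : ℝ)) 1) (ha0 : 0 < a 0)
    (ha2 : Summable fun j => a j * ((j : ℝ) * (j - 1))) {η : ℝ} (hη0 : 0 < η) (hη1 : η ≤ 1)
    (ha3 : Summable fun j => a j * (j : ℝ) ^ (2 + η))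
    (hb0 : ∀ j, 0 ≤ b j) (hb : HasSum b 1) (hb1 : Summable fun j => b j * (j : ℝ))
    (hb2 : Summable fun j => b j * (j : ℝ) ^ 2) (hb0' : 0 < b 0) {β γ : ℝ}
    (hβ : ∑' j, b j * (j : ℝ) = β) (hγ : 1 / 2 * ∑' j, a j * ((j : ℝ) * (j - 1)) = γ)
    (hγ0 : 0 < γ) :
    ∃ L : ℝ, 0 < L ∧ Tendsto (fun n : ℕ => (n : ℝ) ^ (β / γ) *
      ∏ k ∈ Finset.range n, genFun b ((genFun a)^[k] 0)) atTop (𝓝 L) := by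
  have hmem := iterate_genFun_mem h0 ha ha1 ha0
  obtain ⟨c, hc, hle⟩ := exists_one_add_mul_le_inv_one_sub_iterate h0 ha ha1 ha0
  set t : ℕ → ℝ := fun k => 1 - (genFun a)^[k] 0 with ht
  have hpos : ∀ k, 0 < t k := fun k => sub_pos.mpr (hmem k).2
  have hle1 : ∀ k, t k ≤ 1 := fun k => by simp only [ht]; linarith [(hmem k).1]
  have hsucc : ∀ k, t (k + 1) = 1 - genFun a (1 - t k) := fun k => by
    simp only [ht, Function.iterate_succ_apply', sub_sub_cancel]
  -- Dividing `t (k+1) = t - γ t² + O(t ^ (2 + η))` by `t = t k` gives `w k = γ t + O(t ^ (1 + η))`.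
  have hkey := tendsto_rpow_mul_prod (t := t) (w := fun k => 1 - t (k + 1) / t k)
    (x := fun k => 1 - genFun b (1 - t k)) (β := β) (by simp [ht]) hpos hγ0 hη0 hη1 hc hle
    (fun k => by rw [sub_sub_cancel, mul_div_cancel₀ _ (hpos k).ne']) ?_ ?_ ?_
  · simpa only [ht, sub_sub_cancel] using hkey
  · refine IsBigO.of_bound (2 * ∑' j, a j * (j : ℝ) ^ (2 + η)) (Eventually.of_forall fun k => ?_)
    have h1 := abs_genFun_taylor_two_le h0 ha.summable ha1.summable ha2 hη0.le hη1 ha3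
      (hpos k).le (hle1 k)
    rw [ha.tsum_eq, ha1.tsum_eq, hγ, one_mul] at h1
    have e : 1 - t (k + 1) / t k - γ * t k =
        (genFun a (1 - t k) - 1 + t k - γ * t k ^ 2) / t k := by
      have := (hpos k).ne'
      rw [hsucc]; field_simp; ring
    rw [e, norm_div, Real.norm_of_nonneg (hpos k).le, div_le_iff₀ (hpos k), Real.norm_eq_abs,
      Real.norm_of_nonneg (Real.rpow_nonneg (hpos k).le _), mul_assoc,
      ← Real.rpow_add_one (hpos k).ne', show 1 + η + 1 = 2 + η by ring]
    exact h1
  · intro k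
    have := le_genFun hb0 hb (x := 1 - t k) (by linarith [hle1 k]) (by linarith [hpos k])
    linarith
  · refine IsBigO.of_bound (∑' j, b j * (j : ℝ) ^ 2) (Eventually.of_forall fun k => ?_)
    have h1 := abs_genFun_taylor_one_le hb0 hb.summable hb1 hb2 (hpos k).le (hle1 k)
    rw [hb.tsum_eq, hβ] at h1
    rw [Real.norm_of_nonneg (Real.rpow_nonneg (hpos k).le _), Real.norm_eq_abs, ← abs_neg,
      show -(1 - genFun b (1 - t k) - β * t k) = genFun b (1 - t k) - 1 + β * t k by ring]
    refine h1.trans (mul_le_mul_of_nonneg_left ?_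
      (tsum_nonneg fun j => mul_nonneg (hb0 j) (sq_nonneg _)))
    rw [← Real.rpow_natCast]
    exact Real.rpow_le_rpow_of_exponent_ge (hpos k) (hle1 k) (by push_cast; linarith)

end Critical

/-! ### From `[0, ∞]`-valued series back to real generating functions. -/

section PointMass

variable {Ω : Type*} [MeasurableSpace Ω] {P : Measure Ω} {V : Ω → ℕ}

theorem pointMass_nonneg (j : ℕ) : 0 ≤ pointMass P V j := measureReal_nonneg

theorem hasSum_pointMass_mul [IsFiniteMeasure P] (hV : Measurable V) {f : ℕ → ℝ}
    (hf : Integrable (fun ω => f (V ω)) P) :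
    HasSum (fun j => pointMass P V j * f j) (∫ ω, f (V ω) ∂P) := by
  have h := hasSum_integral_iUnion (f := fun ω => f (V ω)) (μ := P)
    (s := fun j => {ω | V ω = j}) (measurableSet_eq_natCast hV) ?_ hf.integrableOn
  · have hu : (⋃ j, {ω | V ω = j}) = Set.univ := by ext; simp
    rw [hu, setIntegral_univ] at h
    have e : (fun j => pointMass P V j * f j) = fun j => ∫ ω in {ω | V ω = j}, f (V ω) ∂P := by
      funext j
      rw [setIntegral_congr_fun (g := fun _ => f j) (measurableSet_eq_natCast hV j)
        fun ω hω => congrArg f hω, setIntegral_const, smul_eq_mul]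
      rfl
    rw [e]
    exact h
  · intro i j hij
    refine Set.disjoint_left.mpr ?_
    rintro ω h1 h2
    exact hij (Eq.trans (Eq.symm h1) h2)

theorem hasSum_pointMass [IsProbabilityMeasure P] (hV : Measurable V) :
    HasSum (pointMass P V) 1 := by
  have := hasSum_pointMass_mul (P := P) hV (f := fun _ => 1) (integrable_const _)
  simpa using this

theorem ennEval_lawSeries [IsProbabilityMeasure P] (hV : Measurable V) {x : ℝ} (hx0 : 0 ≤ x)
    (hx1 : x ≤ 1) :
    PowerSeries.ennEval (lawSeries P V) (ENNReal.ofReal x) =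
      ENNReal.ofReal (genFun (pointMass P V) x) := by
  rw [genFun, ENNReal.ofReal_tsum_of_nonneg
    (fun j => mul_nonneg (pointMass_nonneg j) (pow_nonneg hx0 j))
    (summable_mul_pow_of_nonneg pointMass_nonneg (hasSum_pointMass hV).summable hx0 hx1)]
  refine tsum_congr fun j => ?_
  rw [coeff_lawSeries, ENNReal.ofReal_mul (pointMass_nonneg j), ENNReal.ofReal_pow hx0,
    pointMass, ofReal_measureReal]

theorem iterate_ennEval_lawSeries [IsProbabilityMeasure P] (hV : Measurable V) (k : ℕ) :
    (PowerSeries.ennEval (lawSeries P V))^[k] 0 =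
      ENNReal.ofReal ((genFun (pointMass P V))^[k] 0) := by
  have hmem := iterate_genFun_nonneg_le_one (a := pointMass P V) pointMass_nonneg
    (hasSum_pointMass hV)
  induction k with
  | zero => simp
  | succ k ih =>
    rw [Function.iterate_succ_apply', ih, ennEval_lawSeries hV (hmem k).1 (hmem k).2,
      Function.iterate_succ_apply']

end PointMass

namespace PowerSeries

/-- At the argument `A^m 0` the product for `p n` consists of the factors of ages `m, …, m + n - 1`,
exactly those missing from the product for `p m` at `0`. -/
theorem coeff_zero_mul_ennEval_eq {a b : PowerSeries ℝ≥0∞} {p : ℕ → PowerSeries ℝ≥0∞}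
    (h0 : p 0 = 1) (hs : ∀ n, p (n + 1) = ennSubst a (p n) * b) (n m : ℕ) :
    coeff 0 (p m) * ennEval (p n) ((ennEval a)^[m] 0) = coeff 0 (p (m + n)) := by
  rw [← ennEval_zero, ← ennEval_zero, ennEval_eq_prod h0 hs, ennEval_eq_prod h0 hs,
    ennEval_eq_prod h0 hs, Finset.prod_range_add]
  congr 1
  refine Finset.prod_congr rfl fun k _ => ?_
  rw [add_comm m k, Function.iterate_add_apply]

theorem coeff_pow_mul_le (a : PowerSeries ℝ≥0∞) (j k : ℕ) :
    coeff j a ^ k ≤ coeff (j * k) (a ^ k) := by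
  induction k with
  | zero => simp
  | succ k ih =>
    rw [pow_succ, pow_succ, coeff_mul]
    refine le_trans (mul_le_mul' ih le_rfl) ?_
    exact Finset.single_le_sum (f := fun q : ℕ × ℕ => coeff q.1 (a ^ k) * coeff q.2 a)
      (fun _ _ => zero_le) (a := (j * k, j)) (by simp [mul_add])

theorem coeff_mul_coeff_le (f g : PowerSeries ℝ≥0∞) (i j : ℕ) :
    coeff i f * coeff j g ≤ coeff (i + j) (f * g) := by
  rw [coeff_mul]
  exact Finset.single_le_sum (f := fun q : ℕ × ℕ => coeff q.1 f * coeff q.2 g)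
      (fun _ _ => zero_le) (a := (i, j)) (by simp)

end PowerSeries

/-! ### Summation by parts against a power weight. -/

theorem Nat.cast_rpow_le_cast_rpow (j : ℕ) {s p : ℝ} (hs : 0 < s) (hsp : s ≤ p) :
    (j : ℝ) ^ s ≤ (j : ℝ) ^ p := by
  rcases Nat.eq_zero_or_pos j with rfl | hj
  · simp [Real.zero_rpow hs.ne', Real.zero_rpow (hs.trans_le hsp).ne']
  · exact Real.rpow_le_rpow_of_exponent_le (by exact_mod_cast hj) hsp

/-- Only the block `k ≤ m < 2k` is kept: it has `k` terms, each at least `k ^ (-(r + 1))` thanks to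
the factor `2 ^ (r + 1)`. -/
theorem ofReal_rpow_neg_le_tsum {r : ℝ} (hr : 0 < r) {k : ℕ} (hk : 1 ≤ k) :
    ENNReal.ofReal ((k : ℝ) ^ (-r)) ≤
      ∑' m : ℕ, if k ≤ m then ENNReal.ofReal (2 ^ (r + 1) * (m : ℝ) ^ (-(r + 1))) else 0 := by
  have hk0 : (0 : ℝ) < k := by exact_mod_cast hk
  refine le_trans ?_ (ENNReal.sum_le_tsum (Finset.Ico k (2 * k)))
  have h1 : ∀ m ∈ Finset.Ico k (2 * k), ENNReal.ofReal ((k : ℝ) ^ (-(r + 1))) ≤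
      if k ≤ m then ENNReal.ofReal (2 ^ (r + 1) * (m : ℝ) ^ (-(r + 1))) else 0 := by
    intro m hm
    rw [Finset.mem_Ico] at hm
    rw [if_pos hm.1]
    refine ENNReal.ofReal_le_ofReal ?_
    have hm0 : (0 : ℝ) < m := by exact_mod_cast hk.trans hm.1
    have hm2 : (m : ℝ) ≤ 2 * k := by exact_mod_cast hm.2.le
    have h2 : (2 * (k : ℝ)) ^ (-(r + 1)) ≤ (m : ℝ) ^ (-(r + 1)) :=
      Real.rpow_le_rpow_of_nonpos hm0 hm2 (by linarith)
    calc (k : ℝ) ^ (-(r + 1)) = 2 ^ (r + 1) * (2 * (k : ℝ)) ^ (-(r + 1)) := by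
          rw [Real.mul_rpow (by norm_num) hk0.le, ← mul_assoc,
            ← Real.rpow_add (by norm_num : (0 : ℝ) < 2)]
          simp
      _ ≤ _ := mul_le_mul_of_nonneg_left h2 (by positivity)
  refine le_trans (le_of_eq ?_) (Finset.sum_le_sum h1)
  rw [Finset.sum_const, Nat.card_Ico, show 2 * k - k = k by omega, nsmul_eq_mul,
    ← ENNReal.ofReal_natCast, ← ENNReal.ofReal_mul hk0.le, ← Real.rpow_one_add' hk0.le (by linarith)]
  congr 2; ring

/-- Polynomial control of the partial sums gives control of the sum against a power weight. -/
theorem exists_tsum_mul_rpow_neg_le {C σ r : ℝ} (hC : 0 ≤ C) (hr : 0 < r) (hσr : σ < r) :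
    ∃ K : ℝ≥0∞, K ≠ ⊤ ∧ ∀ (p : ℕ → ℝ≥0∞) (z : ℝ≥0∞),
      (∀ m : ℕ, 1 ≤ m → ∑ k ∈ Finset.range (m + 1), p k ≤ ENNReal.ofReal (C * (m : ℝ) ^ σ) * z) →
      ∑' k : ℕ, p k * (if k = 0 then 0 else ENNReal.ofReal ((k : ℝ) ^ (-r))) ≤ K * z := by
  set u : ℕ → ℝ := fun m => 2 ^ (r + 1) * (m : ℝ) ^ (-(r + 1)) with hu
  have hu0 : ∀ m, 0 ≤ u m := fun m => by positivity
  -- The terms are of order `m ^ (σ - r - 1)`; this is where `σ < r` enters.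
  have hsum : Summable fun m => u m * (C * (m : ℝ) ^ σ) := by
    rw [← summable_nat_add_iff 1]
    have h1 : Summable fun m : ℕ => (m : ℝ) ^ (σ - (r + 1)) :=
      Real.summable_nat_rpow.mpr (by linarith)
    refine (((summable_nat_add_iff 1).mpr h1).mul_left (2 ^ (r + 1) * C)).congr fun m => ?_
    have hm : (0 : ℝ) < ((m + 1 : ℕ) : ℝ) := by positivity
    rw [hu]
    simp only
    rw [sub_eq_add_neg, Real.rpow_add hm]; ring
  refine ⟨∑' m, ENNReal.ofReal (u m * (C * (m : ℝ) ^ σ)), ?_, fun p z hp => ?_⟩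
  · rw [← ENNReal.ofReal_tsum_of_nonneg
      (fun m => mul_nonneg (hu0 m) (mul_nonneg hC (by positivity))) hsum]
    exact ENNReal.ofReal_ne_top
  · have h1 : ∀ k, p k * (if k = 0 then 0 else ENNReal.ofReal ((k : ℝ) ^ (-r))) ≤
        ∑' m, if 1 ≤ k ∧ k ≤ m then p k * ENNReal.ofReal (u m) else 0 := by
      intro k
      split_ifs with hk
      · simp
      · refine (mul_le_mul_right (ofReal_rpow_neg_le_tsum hr (Nat.one_le_iff_ne_zero.mpr hk))
          (p k)).trans ?_
        rw [← ENNReal.tsum_mul_left]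
        refine ENNReal.tsum_le_tsum fun m => ?_
        by_cases hkm : k ≤ m
        · simp [hkm, Nat.one_le_iff_ne_zero.mpr hk, hu]
        · simp [hkm]
    refine (ENNReal.tsum_le_tsum h1).trans ?_
    -- After the exchange the inner sum is `u m` times a partial sum of `p` over `1 ≤ k ≤ m`; it is
    -- empty for `m = 0`, where the hypothesis says nothing.
    rw [ENNReal.tsum_comm, ← ENNReal.tsum_mul_right]
    refine ENNReal.tsum_le_tsum fun m => ?_
    rw [tsum_eq_sum (s := Finset.range (m + 1))]
    · rcases Nat.eq_zero_or_pos m with rfl | hm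
      · simp
      · calc _ ≤ ∑ k ∈ Finset.range (m + 1), p k * ENNReal.ofReal (u m) :=
              Finset.sum_le_sum fun k _ => by split_ifs <;> simp
          _ = ENNReal.ofReal (u m) * ∑ k ∈ Finset.range (m + 1), p k := by
              rw [← Finset.sum_mul, mul_comm]
          _ ≤ ENNReal.ofReal (u m) * (ENNReal.ofReal (C * (m : ℝ) ^ σ) * z) := by
              gcongr; exact hp m hm
          _ = _ := by rw [ENNReal.ofReal_mul (hu0 m), mul_assoc]
    · intro k hk
      rw [Finset.mem_range, not_lt] at hk
      rw [if_neg]; omega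

/-! ### Estimates for the process: emptiness, partial sums of the law, one-step deviations. -/

section GaltonWatson

variable {Ω : Type*} [MeasurableSpace Ω] {P : Measure Ω} {X : ℕ → ℕ → Ω → ℕ} {Y : ℕ → Ω → ℕ}

theorem measure_eq_ofReal_prod [IsProbabilityMeasure P] (h : IsGWIInput P X Y) (n : ℕ) :
    P {ω | gwi X Y n ω = 0} = ENNReal.ofReal (∏ k ∈ Finset.range n,
      genFun (pointMass P (Y 0)) ((genFun (pointMass P (X 0 0)))^[k] 0)) := by
  have hX := h.measurable_X 0 0
  have hY := h.measurable_Y 0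
  have hmem := iterate_genFun_nonneg_le_one (a := pointMass P (X 0 0)) pointMass_nonneg
    (hasSum_pointMass hX)
  rw [← coeff_lawSeries, ← PowerSeries.ennEval_zero,
    PowerSeries.ennEval_eq_prod (p := fun n => lawSeries P (gwi X Y n)) h.lawSeries_gwi_zero
      h.lawSeries_gwi_succ,
    ENNReal.ofReal_prod_of_nonneg fun k _ => (pointMass_nonneg 0).trans
      (le_genFun pointMass_nonneg (hasSum_pointMass hY) (hmem k).1 (hmem k).2)]
  refine Finset.prod_congr rfl fun k _ => ?_
  rw [iterate_ennEval_lawSeries hX, ennEval_lawSeries hY (hmem k).1 (hmem k).2]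

end GaltonWatson

section GaltonWatson

variable {Ω : Type*} [MeasurableSpace Ω] {P : Measure Ω} {X : ℕ → ℕ → Ω → ℕ} {Y : ℕ → Ω → ℕ}

/-- The probability that `k` individuals together with the immigrants produce a number of
individuals deviating from `k` by more than `ε * k`; zero by convention for `k = 0`. -/
noncomputable def stepDeviation (P : Measure Ω) (X : ℕ → ℕ → Ω → ℕ) (Y : ℕ → Ω → ℕ) (ε : ℝ)
    (k : ℕ) : ℝ≥0∞ :=
  if k = 0 then 0 else P ((fun ω => ∑ i ∈ Finset.range k, X 0 i ω + Y 0 ω) ⁻¹'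
    {j | ε < |(j : ℝ) / (k : ℝ) - 1|})

theorem measure_preimage_congr {V W : Ω → ℕ} (hV : Measurable V) (hW : Measurable W)
    (h : lawSeries P V = lawSeries P W) (s : Set ℕ) : P (V ⁻¹' s) = P (W ⁻¹' s) := by
  classical
  rw [measure_preimage_eq_tsum hV, measure_preimage_eq_tsum hW]
  simp_rw [← coeff_lawSeries, h]

theorem measure_pos_inter_ratioDeviation (h : IsGWIInput P X Y) (ε : ℝ) (n : ℕ) :
    P ({ω | 0 < gwi X Y n ω} ∩ ratioDeviation X Y ε n) =
      ∑' k, P {ω | gwi X Y n ω = k} * stepDeviation P X Y ε k := by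
  rw [measure_eq_tsum_inter (h.measurable_gwi n)]
  refine tsum_congr fun k => ?_
  rw [stepDeviation]
  split_ifs with hk
  · rw [mul_zero, measure_eq_zero_iff_ae_notMem]
    refine ae_of_all _ ?_
    rintro ω ⟨h1, h2, -⟩
    simp only [Set.mem_ofPred_eq] at h1 h2
    omega
  -- Time homogeneity: `stepDeviation` uses the inputs of time `0`, but the law of the sum is the
  -- same at time `n`.
  · rw [measure_preimage_congr (h.measurable_sum_add 0 k) (h.measurable_sum_add n k)
      (by rw [h.lawSeries_sum_add, h.lawSeries_sum_add]), ← h.measure_gwi_inter]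
    congr 1
    ext ω
    simp only [ratioDeviation, Set.mem_inter_iff, Set.mem_ofPred_eq, Set.mem_preimage]
    constructor
    · rintro ⟨h1, -, h3⟩; rw [h1] at h3; exact ⟨h1, h3⟩
    · rintro ⟨h1, h3⟩; rw [h1]; exact ⟨rfl, Nat.pos_of_ne_zero hk, h3⟩

/-- Each ratio `P (Z_n = k) / P (Z_n = 0)` is nondecreasing in `n`, hence so is any combination with
nonnegative weights `φ`. -/
theorem monotone_deviation_div (h : IsGWIInput P X Y)
    (h0 : ∀ n, P {ω | gwi X Y n ω = 0} ≠ 0) (φ : ℕ → ℝ≥0∞) :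
    Monotone fun n => (∑' k, P {ω | gwi X Y n ω = k} * φ k) / P {ω | gwi X Y n ω = 0} := by
  have : IsProbabilityMeasure P := h.indep_X.isProbabilityMeasure
  refine monotone_nat_of_le_succ fun n => ?_
  refine ENNReal.div_le_of_le_mul ?_
  rw [← ENNReal.mul_div_right_comm, ENNReal.le_div_iff_mul_le (Or.inl (h0 _))
    (Or.inl (measure_ne_top _ _)), ← ENNReal.tsum_mul_right, ← ENNReal.tsum_mul_right]
  refine ENNReal.tsum_le_tsum fun k => ?_
  have := PowerSeries.coeff_zero_mul_coeff_succ_ge (p := fun n => lawSeries P (gwi X Y n))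
    h.lawSeries_gwi_zero h.lawSeries_gwi_succ n k
  simp only [coeff_lawSeries] at this
  rw [mul_right_comm, mul_right_comm _ (φ k)]
  gcongr

theorem integrable_cast_pow_of_rpow {V : Ω → ℕ} [IsFiniteMeasure P] (hV : Measurable V) {s p : ℝ}
    (hs : 0 < s) (hsp : s ≤ p) (hint : Integrable (fun ω => (V ω : ℝ) ^ p) P) :
    Integrable (fun ω => (V ω : ℝ) ^ s) P := by
  refine hint.mono ?_ (ae_of_all _ fun ω => ?_)
  · exact ((measurable_from_nat (f := fun j : ℕ => (j : ℝ) ^ s)).comp hV).aestronglyMeasurable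
  · rw [Real.norm_of_nonneg (by positivity), Real.norm_of_nonneg (by positivity)]
    exact Nat.cast_rpow_le_cast_rpow _ hs hsp

variable [IsProbabilityMeasure P] {β γ : ℝ}

theorem ConditionH.hasSum_mean (h : IsGWIInput P X Y) (hH : ConditionH P X Y β γ) :
    HasSum (fun j => pointMass P (X 0 0) j * (j : ℝ)) 1 := by
  have hint : Integrable (fun ω => (X 0 0 ω : ℝ)) P := by
    -- A non-integrable function has integral `0` by convention, not `1`.
    by_contra hcon
    have := hH.mean_offspring
    rw [integral_undef hcon] at this
    exact zero_ne_one this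
  rw [← hH.mean_offspring]
  exact hasSum_pointMass_mul (h.measurable_X 0 0) (f := fun j => (j : ℝ)) hint

/-- `P (Z_n = 0)` decays like `n ^ (-β / γ)`. -/
theorem exists_tendsto_rpow_mul_measureReal_eq_zero (h : IsGWIInput P X Y)
    (hH : ConditionH P X Y β γ) {p : ℝ} (hp : 2 < p)
    (hX : Integrable (fun ω => (X 0 0 ω : ℝ) ^ p) P) :
    ∃ L : ℝ, 0 < L ∧ Tendsto (fun n : ℕ => (n : ℝ) ^ (β / γ) * P.real {ω | gwi X Y n ω = 0})
      atTop (𝓝 L) := by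
  -- The Taylor estimate needs `η ≤ 1`, the moment hypothesis `2 + η ≤ p`.
  set η := min 1 (p - 2) with hη
  have hη0 : 0 < η := lt_min one_pos (by linarith)
  have hXη := integrable_cast_pow_of_rpow (h.measurable_X 0 0) (s := 2 + η) (by linarith)
    (by linarith [min_le_right 1 (p - 2)]) hX
  have ha := hasSum_pointMass (P := P) (h.measurable_X 0 0)
  have hb := hasSum_pointMass (P := P) (h.measurable_Y 0)
  have ha1 := hH.hasSum_mean h
  have ha3 : Summable fun j => pointMass P (X 0 0) j * (j : ℝ) ^ (2 + η) :=
    (hasSum_pointMass_mul (h.measurable_X 0 0) (f := fun j => (j : ℝ) ^ (2 + η)) hXη).summable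
  have ha2 : Summable fun j => pointMass P (X 0 0) j * ((j : ℝ) * (j - 1)) := by
    refine ha3.of_nonneg_of_le (fun j => mul_nonneg (pointMass_nonneg j) ?_)
      fun j => mul_le_mul_of_nonneg_left ?_ (pointMass_nonneg j)
    · rcases j with _ | j
      · simp
      · push_cast; simp only [add_sub_cancel_right]; positivity
    · have h1 := Nat.cast_pow_le_cast_rpow j (m := 2) (s := 2 + η) (by push_cast; linarith)
        (by linarith) two_ne_zero
      have h2 : (0 : ℝ) ≤ j := j.cast_nonneg
      nlinarith
  have hb1 : Summable fun j => pointMass P (Y 0) j * (j : ℝ) := by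
    refine hH.summable_b.of_nonneg_of_le (fun j => mul_nonneg (pointMass_nonneg j) j.cast_nonneg)
      fun j => mul_le_mul_of_nonneg_left ?_ (pointMass_nonneg j)
    exact_mod_cast Nat.le_self_pow two_ne_zero j
  have hβ := tendsto_nhds_unique (tendsto_deriv_genFun pointMass_nonneg hb1) hH.tendsto_beta
  have hγ := tendsto_nhds_unique ((tendsto_iteratedDeriv_two_genFun pointMass_nonneg
    ha1.summable ha2).const_mul (1 / 2)) hH.tendsto_gamma
  obtain ⟨L, hL, hlim⟩ := exists_tendsto_rpow_mul_prod_genFun pointMass_nonneg ha ha1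
    hH.a_zero_pos ha2 hη0 (min_le_left _ _) ha3 pointMass_nonneg hb hb1 hH.summable_b
    hH.b_zero_pos hβ hγ hH.gamma_pos
  refine ⟨L, hL, hlim.congr fun n => ?_⟩
  rw [measureReal_def, measure_eq_ofReal_prod h, ENNReal.toReal_ofReal]
  refine Finset.prod_nonneg fun k _ => ?_
  have hmem := iterate_genFun_nonneg_le_one pointMass_nonneg ha k
  exact (pointMass_nonneg 0).trans (le_genFun pointMass_nonneg hb hmem.1 hmem.2)

theorem measure_gwi_eq_zero_pos (h : IsGWIInput P X Y) (hH : ConditionH P X Y β γ) (n : ℕ) :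
    0 < P {ω | gwi X Y n ω = 0} := by
  rw [measure_eq_ofReal_prod h, ENNReal.ofReal_pos]
  refine Finset.prod_pos fun k _ => ?_
  have hmem := iterate_genFun_nonneg_le_one pointMass_nonneg
    (hasSum_pointMass (P := P) (h.measurable_X 0 0)) k
  exact hH.b_zero_pos.trans_le (le_genFun pointMass_nonneg
    (hasSum_pointMass (h.measurable_Y 0)) hmem.1 hmem.2)

theorem measure_gwi_eq_zero_antitone (h : IsGWIInput P X Y) :
    Antitone fun n => P {ω | gwi X Y n ω = 0} := by
  refine antitone_nat_of_succ_le fun n => ?_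
  rw [measure_eq_ofReal_prod h, measure_eq_ofReal_prod h, Finset.prod_range_succ]
  refine ENNReal.ofReal_le_ofReal ?_
  have hmem := iterate_genFun_nonneg_le_one pointMass_nonneg
    (hasSum_pointMass (P := P) (h.measurable_X 0 0))
  have hb := hasSum_pointMass (P := P) (h.measurable_Y 0)
  exact mul_le_of_le_one_right (Finset.prod_nonneg fun k _ => (pointMass_nonneg 0).trans
    (le_genFun pointMass_nonneg hb (hmem k).1 (hmem k).2))
    (genFun_le_one pointMass_nonneg hb (hmem n).1 (hmem n).2)

/-- Take `x = A^m 0`. For `k ≤ m`, `x ^ k ≥ x ^ m ≥ exp (-1/c)`, so the partial sum is at most a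
constant times `E[x ^ Z_n]`. Moreover `P (Z_m = 0) * E[x ^ Z_n] = P (Z_{m+n} = 0) ≤ P (Z_n = 0)`,
and `1 / P (Z_m = 0)` is of order `m ^ (β / γ)`. -/
theorem exists_sum_measure_gwi_eq_le (h : IsGWIInput P X Y)
    (hH : ConditionH P X Y β γ) {p : ℝ} (hp : 2 < p)
    (hX : Integrable (fun ω => (X 0 0 ω : ℝ) ^ p) P) :
    ∃ C : ℝ, 0 ≤ C ∧ ∀ n m : ℕ, 1 ≤ m → ∑ k ∈ Finset.range (m + 1), P {ω | gwi X Y n ω = k} ≤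
      ENNReal.ofReal (C * (m : ℝ) ^ (β / γ)) * P {ω | gwi X Y n ω = 0} := by
  obtain ⟨L, hL, hlim⟩ := exists_tendsto_rpow_mul_measureReal_eq_zero h hH hp hX
  have ha := hasSum_pointMass (P := P) (h.measurable_X 0 0)
  obtain ⟨c, hc, hle⟩ := exists_one_add_mul_le_inv_one_sub_iterate pointMass_nonneg ha
    (hH.hasSum_mean h) hH.a_zero_pos
  have hmem := iterate_genFun_mem pointMass_nonneg ha (hH.hasSum_mean h) hH.a_zero_pos
  obtain ⟨K, hK⟩ := (hlim.inv₀ hL.ne').bddAbove_range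
  have hK' : ∀ m : ℕ, 1 ≤ m → 0 ≤ K ∧ 1 ≤ K * (m : ℝ) ^ (β / γ) * P.real {ω | gwi X Y m ω = 0} := by
    intro m hm
    have h1 : ((m : ℝ) ^ (β / γ) * P.real {ω | gwi X Y m ω = 0})⁻¹ ≤ K := hK ⟨m, rfl⟩
    have h2 : 0 < P.real {ω | gwi X Y m ω = 0} :=
      ENNReal.toReal_pos (measure_gwi_eq_zero_pos h hH m).ne' (measure_ne_top _ _)
    have hm0 : (0 : ℝ) < m := by exact_mod_cast hm
    have h3 : 0 < (m : ℝ) ^ (β / γ) * P.real {ω | gwi X Y m ω = 0} := by positivity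
    refine ⟨(inv_pos.mpr h3).le.trans h1, ?_⟩
    rw [mul_assoc]
    exact (inv_le_iff_one_le_mul₀ h3).mp h1
  set E := Real.exp (-c⁻¹) with hE
  have hE0 : 0 < E := Real.exp_pos _
  refine ⟨K / E, div_nonneg (hK' 1 le_rfl).1 hE0.le, fun n m hm => ?_⟩
  set S := ∑ k ∈ Finset.range (m + 1), P {ω | gwi X Y n ω = k} with hS
  set x := (genFun (pointMass P (X 0 0)))^[m] 0 with hx
  have hx0 : 0 ≤ x := (hmem m).1
  have hx1 : x < 1 := (hmem m).2
  have hEx : E ≤ x ^ m := by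
    have h1 : 1 - x ≤ (1 + c * m)⁻¹ := by
      rw [le_inv_comm₀ (by linarith) (by positivity)]; exact hle m
    simpa using exp_neg_inv_le_one_sub_pow hc hm h1
  have h1 : S * ENNReal.ofReal E ≤
      PowerSeries.ennEval (lawSeries P (gwi X Y n)) (ENNReal.ofReal x) := by
    refine le_trans ?_ (ENNReal.sum_le_tsum (Finset.range (m + 1)))
    rw [hS, Finset.sum_mul]
    refine Finset.sum_le_sum fun k hk => ?_
    rw [coeff_lawSeries, ← ENNReal.ofReal_pow hx0]
    gcongr
    exact hEx.trans (pow_le_pow_of_le_one hx0 hx1.le (by simpa [Nat.lt_succ_iff] using hk))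
  have h2 : P {ω | gwi X Y m ω = 0} *
      PowerSeries.ennEval (lawSeries P (gwi X Y n)) (ENNReal.ofReal x) ≤
        P {ω | gwi X Y n ω = 0} := by
    have h3 := PowerSeries.coeff_zero_mul_ennEval_eq (p := fun n => lawSeries P (gwi X Y n))
      h.lawSeries_gwi_zero h.lawSeries_gwi_succ n m
    rw [iterate_ennEval_lawSeries (h.measurable_X 0 0)] at h3
    simp only [coeff_lawSeries] at h3
    rw [h3]
    exact measure_gwi_eq_zero_antitone h (Nat.le_add_left n m)
  obtain ⟨hK0, hKm⟩ := hK' m hm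
  have h4 : (1 : ℝ≥0∞) ≤ ENNReal.ofReal (K / E * (m : ℝ) ^ (β / γ)) *
      (ENNReal.ofReal E * P {ω | gwi X Y m ω = 0}) := by
    rw [← ofReal_measureReal (measure_ne_top P _), ← ENNReal.ofReal_mul hE0.le,
      ← ENNReal.ofReal_mul (by positivity), ENNReal.one_le_ofReal]
    have e : K / E * (m : ℝ) ^ (β / γ) * (E * P.real {ω | gwi X Y m ω = 0}) =
        K * (m : ℝ) ^ (β / γ) * P.real {ω | gwi X Y m ω = 0} := by
      field_simp
    rw [e]; exact hKm
  calc S = S * 1 := (mul_one S).symm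
    _ ≤ S * (ENNReal.ofReal (K / E * (m : ℝ) ^ (β / γ)) *
      (ENNReal.ofReal E * P {ω | gwi X Y m ω = 0})) := by gcongr
    _ = ENNReal.ofReal (K / E * (m : ℝ) ^ (β / γ)) *
      (P {ω | gwi X Y m ω = 0} * (S * ENNReal.ofReal E)) := by ring
    _ ≤ _ := by
      gcongr
      exact le_trans (by gcongr) h2

/-- A polynomial bound for the probability of a deviation in a single step. -/
theorem exists_stepDeviation_le (h : IsGWIInput P X Y) (hH : ConditionH P X Y β γ)
    {r p : ℝ} (hr : 1 < r) (hp : r + 1 ≤ p)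
    (hX : Integrable (fun ω => (X 0 0 ω : ℝ) ^ p) P)
    (hY : Integrable (fun ω => (Y 0 ω : ℝ) ^ r) P) {ε : ℝ} (hε : 0 < ε) :
    ∃ C : ℝ, 0 ≤ C ∧ ∀ k, stepDeviation P X Y ε k ≤
      ENNReal.ofReal C * (if k = 0 then 0 else ENNReal.ofReal ((k : ℝ) ^ (-r))) := by
  have hcast : Measurable fun j : ℕ => (j : ℝ) := measurable_from_nat
  let U : ℕ → Ω → ℝ := fun i ω => (X 0 i ω : ℝ)
  have hUm : ∀ i, Measurable (U i) := fun i => hcast.comp (h.measurable_X 0 i)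
  have hUi : iIndepFun U P := (h.indep_X.precomp (g := fun i : ℕ => ((0 : ℕ), i))
    fun i j hij => (Prod.mk.inj hij).2).comp (fun _ j => (j : ℝ)) fun _ => hcast
  have hUid : ∀ i, IdentDistrib (U i) (U 0) P P := fun i => (h.identDistrib_X 0 i).comp hcast
  have hU0 : ∀ i ω, 0 ≤ U i ω := fun i ω => Nat.cast_nonneg _
  have hU1 : Integrable (U 0) P := by
    have := integrable_cast_pow_of_rpow (h.measurable_X 0 0) one_pos (by linarith) hX
    simpa only [Real.rpow_one] using this
  have hU2 : Integrable (fun ω => U 0 ω ^ 2) P := by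
    have := integrable_cast_pow_of_rpow (h.measurable_X 0 0) two_pos (by linarith) hX
    simpa only [Real.rpow_two] using this
  obtain ⟨C₁, hC1, h1⟩ := exists_measureReal_sum_gt_le hUm hUi hUid hU0 hU1 hU2
    hH.mean_offspring (by linarith : 0 < r) hp hX (half_pos hε)
  obtain ⟨C₂, hC2, h2⟩ := exists_measureReal_sum_lt_le hUm hUi hUid hU0 hU1 hU2
    hH.mean_offspring (by linarith : 0 < r) hε
  set mY := ∫ ω, (Y 0 ω : ℝ) ^ r ∂P with hmY
  have hmY0 : 0 ≤ mY := integral_nonneg fun ω => by positivity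
  refine ⟨C₁ + C₂ + mY * (ε / 2) ^ (-r), by positivity, fun k => ?_⟩
  rw [stepDeviation]
  split_ifs with hk
  · simp
  have hk1 : 1 ≤ k := Nat.one_le_iff_ne_zero.mpr hk
  have hk0 : (0 : ℝ) < k := by exact_mod_cast hk1
  have h3 : P.real {ω | ε / 2 * k < (Y 0 ω : ℝ)} ≤ mY * (ε / 2) ^ (-r) * (k : ℝ) ^ (-r) := by
    rw [mul_assoc, ← Real.mul_rpow (by positivity) hk0.le]
    exact measureReal_gt_le_moment (fun ω => Nat.cast_nonneg _) (by linarith) (by positivity) hY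
  -- An upward deviation is shared, `ε / 2` each, between children and immigrants; for a downward
  -- one immigrants can only help, so the children alone fall short by `ε`.
  have hsub : (fun ω => ∑ i ∈ Finset.range k, X 0 i ω + Y 0 ω) ⁻¹'
      {j | ε < |(j : ℝ) / (k : ℝ) - 1|} ⊆
      ({ω | (1 + ε / 2) * k < ∑ i ∈ Finset.range k, U i ω} ∪
        {ω | ∑ i ∈ Finset.range k, U i ω < (1 - ε) * k}) ∪
          {ω | ε / 2 * k < (Y 0 ω : ℝ)} := by
    intro ω hω
    simp only [Set.mem_preimage, Set.mem_ofPred_eq, Set.mem_union] at hω ⊢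
    have e : ((∑ i ∈ Finset.range k, X 0 i ω + Y 0 ω : ℕ) : ℝ) =
        ∑ i ∈ Finset.range k, U i ω + Y 0 ω := by push_cast; rfl
    rw [e] at hω
    have hY0 : (0 : ℝ) ≤ Y 0 ω := Nat.cast_nonneg _
    rcases lt_abs.mp hω with hlt | hlt
    · have : (1 + ε) * k < ∑ i ∈ Finset.range k, U i ω + Y 0 ω := by
        rw [← lt_div_iff₀ hk0]; linarith
      by_cases hYk : ε / 2 * k < (Y 0 ω : ℝ)
      · exact Or.inr hYk
      · exact Or.inl (Or.inl (by linarith))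
    · have : ∑ i ∈ Finset.range k, U i ω + Y 0 ω < (1 - ε) * k := by
        rw [← div_lt_iff₀ hk0]; linarith
      exact Or.inl (Or.inr (by linarith))
  rw [← ENNReal.ofReal_mul (by positivity), ← ofReal_measureReal (measure_ne_top P _)]
  refine ENNReal.ofReal_le_ofReal ?_
  refine (measureReal_mono hsub).trans ((measureReal_union_le _ _).trans
    ((add_le_add (measureReal_union_le _ _) le_rfl).trans ?_))
  linarith [h1 k hk1, h2 k hk1]

/-- Let `k ≥ 1` immigrants arrive, each have `j ≥ 2` children, and `k` more immigrants follow: then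
`Z_2 / Z_1 - 1 = j > 1 ≥ ε`, with positive probability. -/
theorem exists_pos_measure_deviation (h : IsGWIInput P X Y) (hH : ConditionH P X Y β γ)
    {ε : ℝ} (hε : ε ≤ 1) :
    ∃ n : ℕ, 0 < P ({ω | 0 < gwi X Y n ω} ∩ ratioDeviation X Y ε n) := by
  obtain ⟨j, hj, haj⟩ := exists_two_le_pos_of_mean_one pointMass_nonneg
    (hasSum_pointMass (P := P) (h.measurable_X 0 0)) (hH.hasSum_mean h) hH.a_zero_pos
  obtain ⟨k, hk, hbk⟩ : ∃ k, k ≠ 0 ∧ 0 < pointMass P (Y 0) k := by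
    by_contra! hcon
    have h1 := hasSum_pointMass (P := P) (h.measurable_Y 0)
    have h2 := hasSum_single (f := pointMass P (Y 0)) 0 fun k hk =>
      le_antisymm (hcon k hk) (pointMass_nonneg k)
    linarith [h1.unique h2, hH.b_zero_lt_one]
  have haj' : 0 < PowerSeries.coeff j (lawSeries P (X 0 0)) := by
    rw [coeff_lawSeries]; exact (ENNReal.toReal_pos_iff.mp haj).1
  have hbk' : 0 < PowerSeries.coeff k (lawSeries P (Y 0)) := by
    rw [coeff_lawSeries]; exact (ENNReal.toReal_pos_iff.mp hbk).1
  refine ⟨1, ?_⟩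
  rw [measure_pos_inter_ratioDeviation h]
  refine lt_of_lt_of_le ?_ (ENNReal.le_tsum k)
  refine ENNReal.mul_pos ?_ ?_
  · have h1 : {ω | gwi X Y 1 ω = k} = {ω | Y 0 ω = k} := by ext ω; simp [gwi]
    rw [h1, ← coeff_lawSeries]
    exact hbk'.ne'
  · rw [stepDeviation, if_neg hk]
    refine ne_of_gt (lt_of_lt_of_le ?_ (measure_mono
      (s := {ω | ∑ i ∈ Finset.range k, X 0 i ω + Y 0 ω = j * k + k}) ?_))
    · rw [← coeff_lawSeries P (fun ω => ∑ i ∈ Finset.range k, X 0 i ω + Y 0 ω),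
        h.lawSeries_sum_add]
      refine lt_of_lt_of_le ?_ ((mul_le_mul' (PowerSeries.coeff_pow_mul_le _ j k) le_rfl).trans
        (PowerSeries.coeff_mul_coeff_le _ _ _ _))
      exact ENNReal.mul_pos (pow_ne_zero _ haj'.ne') hbk'.ne'
    · intro ω hω
      simp only [Set.mem_ofPred_eq, Set.mem_preimage] at hω ⊢
      rw [hω]
      have hk0 : (0 : ℝ) < k := by exact_mod_cast Nat.pos_of_ne_zero hk
      have hj2 : (2 : ℝ) ≤ j := by exact_mod_cast hj
      have e : ((j * k + k : ℕ) : ℝ) / k - 1 = j := by push_cast; field_simp; ring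
      rw [e, abs_of_nonneg (by linarith)]
      linarith

end GaltonWatson

/-! ### Conclusion. -/

theorem corollary3p2 {Ω : Type*} [MeasurableSpace Ω] (P : Measure Ω) [IsProbabilityMeasure P]
    (X : ℕ → ℕ → Ω → ℕ) (Y : ℕ → Ω → ℕ) (hXY : IsGWIInput P X Y)
    (β γ : ℝ) (hH : ConditionH P X Y β γ)
    (r δ : ℝ) (hδ : 0 < δ) (hr : max (β / γ) 1 < r)
    (hX : Integrable (fun ω => (X 0 0 ω : ℝ) ^ (2 * r + δ)) P)
    (hY : Integrable (fun ω => (Y 0 ω : ℝ) ^ r) P)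
    (ε : ℝ) (hε : 0 < ε) :
    ∃ q : ℝ, 0 ≤ q ∧
      Tendsto (fun n : ℕ => (n : ℝ) ^ (β / γ) *
          (ProbabilityTheory.cond P {ω | 0 < gwi X Y n ω}).real (ratioDeviation X Y ε n))
        atTop (𝓝 q) ∧
      (0 < q ↔ ∃ n : ℕ, 0 < P ({ω | 0 < gwi X Y n ω} ∩ ratioDeviation X Y ε n)) ∧
      (ε ≤ 1 → 0 < q) := by
  have hr1 : 1 < r := (le_max_right _ _).trans_lt hr
  have hσr : β / γ < r := (le_max_left _ _).trans_lt hr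
  have hσ : 0 < β / γ := div_pos hH.beta_pos hH.gamma_pos
  have hp : 2 < 2 * r + δ := by linarith
  obtain ⟨L, hL, hlim⟩ := exists_tendsto_rpow_mul_measureReal_eq_zero hXY hH hp hX
  obtain ⟨C, hC, hsum⟩ := exists_sum_measure_gwi_eq_le hXY hH hp hX
  -- The moment order `2 * r + δ` is at least `r + 1` because `r > 1`.
  obtain ⟨D, hD, hstep⟩ := exists_stepDeviation_le hXY hH hr1 (by linarith) hX hY hε
  obtain ⟨K, hK, htail⟩ := exists_tsum_mul_rpow_neg_le hC (by linarith : 0 < r) hσr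
  have hpos := fun n => measure_gwi_eq_zero_pos hXY hH n
  set dev : ℕ → ℝ≥0∞ := fun n => P ({ω | 0 < gwi X Y n ω} ∩ ratioDeviation X Y ε n) with hdev
  set s : ℕ → ℝ≥0∞ := fun n => dev n / P {ω | gwi X Y n ω = 0} with hs
  have hmono : Monotone s := by
    have := monotone_deviation_div hXY (fun n => (hpos n).ne') (stepDeviation P X Y ε)
    simp only [hs, hdev, measure_pos_inter_ratioDeviation hXY]
    exact this
  have hbound : ∀ n, s n ≤ ENNReal.ofReal D * K := by
    intro n
    refine ENNReal.div_le_of_le_mul ?_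
    rw [hdev]
    simp only
    rw [measure_pos_inter_ratioDeviation hXY, mul_assoc]
    refine le_trans ?_ (mul_le_mul_right (htail _ _ (hsum n)) (ENNReal.ofReal D))
    rw [← ENNReal.tsum_mul_left]
    refine ENNReal.tsum_le_tsum fun k => ?_
    rw [mul_left_comm]
    exact mul_le_mul_right (hstep k) _
  have hbtop : ENNReal.ofReal D * K ≠ ⊤ := ENNReal.mul_ne_top ENNReal.ofReal_ne_top hK
  set q' := ⨆ n, s n with hq'
  have hq'top : q' ≠ ⊤ := ne_top_of_le_ne_top hbtop (iSup_le hbound)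
  have hslim : Tendsto (fun n => (s n).toReal) atTop (𝓝 q'.toReal) :=
    (ENNReal.tendsto_toReal hq'top).comp (tendsto_atTop_iSup hmono)
  have hzero : Tendsto (fun n : ℕ => P.real {ω | gwi X Y n ω = 0}) atTop (𝓝 0) := by
    have h1 : Tendsto (fun n : ℕ => (n : ℝ) ^ (-(β / γ))) atTop (𝓝 0) :=
      (tendsto_rpow_neg_atTop hσ).comp tendsto_natCast_atTop_atTop
    have h2 := hlim.mul h1
    rw [mul_zero] at h2
    refine h2.congr' ?_
    filter_upwards [eventually_gt_atTop 0] with n hn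
    have hn0 : (0 : ℝ) < n := by exact_mod_cast hn
    rw [mul_right_comm, ← Real.rpow_add hn0, add_neg_cancel, Real.rpow_zero, one_mul]
  have hcompl : ∀ n, P.real {ω | 0 < gwi X Y n ω} = 1 - P.real {ω | gwi X Y n ω = 0} := by
    intro n
    rw [← probReal_compl_eq_one_sub (measurableSet_eq_natCast (hXY.measurable_gwi n) 0)]
    congr 1; ext ω; simp [Nat.pos_iff_ne_zero]
  have hq : 0 < L * q'.toReal ↔ ∃ n, 0 < dev n := by
    rw [mul_pos_iff_of_pos_left hL, ENNReal.toReal_pos_iff, hq', lt_iSup_iff]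
    constructor
    · rintro ⟨⟨n, hn⟩, -⟩
      exact ⟨n, (ENNReal.div_pos_iff.mp hn).1.bot_lt⟩
    · rintro ⟨n, hn⟩
      exact ⟨⟨n, ENNReal.div_pos hn.ne' (measure_ne_top _ _)⟩, hq'top.lt_top⟩
  refine ⟨L * q'.toReal, by positivity, ?_, hq,
    fun hε1 => hq.mpr (exists_pos_measure_deviation hXY hH hε1)⟩
  -- The scaled conditional probability factors as `n ^ σ * P (Z_n = 0)`, times `s n`, times `1 / P
  -- (Z_n > 0)`, with limits `L`, `q'` and `1`.
  have hfinal := (hlim.mul hslim).mul ((hzero.const_sub 1).inv₀ (by norm_num))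
  rw [sub_zero, inv_one, mul_one] at hfinal
  refine hfinal.congr fun n => ?_
  have hposset : MeasurableSet {ω | 0 < gwi X Y n ω} :=
    hXY.measurable_gwi n measurableSet_Ioi
  rw [← hcompl, measureReal_def (cond P _), cond_apply hposset, ENNReal.toReal_mul,
    ENNReal.toReal_inv, ← measureReal_def, ← measureReal_def]
  have h1 : P.real {ω | gwi X Y n ω = 0} * (s n).toReal =
      P.real ({ω | 0 < gwi X Y n ω} ∩ ratioDeviation X Y ε n) := by
    rw [measureReal_def, ← ENNReal.toReal_mul, hs]
    simp only
    rw [ENNReal.mul_div_cancel (hpos n).ne' (measure_ne_top _ _), measureReal_def]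
  rw [← h1]; ring
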